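/- **Equidistribution at logarithmical scales.** Let $M\in\mathrm{SL}(2,\mathbb Z)$ with $|\mathrm{Tr}\,M|>2$. Write $M=\varepsilon\exp\begin{pmatrix} c & b\\ -a & -c\end{pmatrix}$ with $\varepsilon\in\{1,-1\}$, $a,b,c\in\mathbb R$ and $ab<c^2$. For an integer $N\ge1$ put $h=1/N$, let $\hat q f(q)=qf(q)$, $\hat p=\frac{h}{2\pi i}\frac{d}{dq}$, and $\hat H=\frac12a\hat q^2+\frac12b\hat p^2+\frac c2(\hat q\hat p+\hat p\hat q)$. Let $e^{-2\pi i\hat H/h}$ be the time-one map of the Schrödinger equation $\frac{ih}{2\pi}\partial_t\psi=\hat H\psi$ on $\mathcal S(\mathbb R)$, and let $\hat M=e^{-2\pi i\hat H/h}$ if $\varepsilon=1$, and $\hat M=R\,e^{-2\pi i\hat H/h}$ with $(Rf)(q)=f(-q)$ if $\varepsilon=-1$. Extend $\hat M$ to tempered distributions by duality, $\langle\hat M\psi,\hat Mf\rangle=\langle\psi,f\rangle$ for all $f\in\mathcal S(\mathbb R)$. For $\kappa=(\kappa_1,\kappa_2)\in\mathbb R^2$ let $\mathcal H_{N,\kappa}$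 be the $N$-dimensional space of distributions $$\psi=\sum_{k\in\mathbb Z}\Psi(k)\,\delta\bigl(q-(k+\kappa_1)/N\bigr),\qquad \Psi(k+N)=e^{-2\pi i\kappa_2}\Psi(k),$$ with inner product $\langle\psi,\phi\rangle=\frac1N\sum_{k=1}^N\Psi(k)\overline{\Phi(k)}$. For such $\psi$ and a ball $B\subset\mathbb T^1=\mathbb R/\mathbb Z$ let $$\int_B|\psi|^2\,d\mathrm{Vol}:=\frac1N\sum_{\substack{1\le k\le N\\ (k+\kappa_1)/N\,\in\,B\ (\mathrm{mod}\ 1)}}|\Psi(k)|^2 .$$ Let $0\le\alpha<1/2$ and $r=r(N)=(\log N)^{-\alpha}$. For each $N\ge1$ let $\kappa=\kappa(N)$ be such that $\hat M$ maps $\mathcal H_N:=\mathcal H_{N,\kappa}$ to itself, and let $\{\phi_j\}_{j=1}^N=\{\phi_j^{(N)}\}_{j=1}^N$ be any orthonormal basis of $\mathcal H_N$ with $\hat M\phi_j=e^{i\theta_j}\phi_j$, $\theta_j\in\mathbb R$. Then there are subsets $S(N)\subset\{1,\dots,N\}$ with $\#S(N)/N\to1$ as $N\to\infty$ such that $$\int_{B_1(q,r)}|\phi_j|^2\,d\mathrm{Vol}=\mathrm{Vol}(B_1(q,r))+o(r)\qquad\text{as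 }N\to\infty,$$ uniformly for all $j\in S(N)$ and all $q\in\mathbb T^1$, where $B_1(q,r)$ is the open ball in $\mathbb T^1$ and $\mathrm{Vol}$ its length. -/

import Mathlib

open scoped SchwartzMap FourierTransform ENNReal Topology ComplexConjugate
open MeasureTheory Filter

noncomputable section

namespace QuantumCat

/-! ### The quantized quadratic Hamiltonian on the line, with Planck constant `h = 1 / N` -/

/-- The position operator `f(q) ↦ q f(q)`. -/
def posOp : 𝓢(ℝ, ℂ) →L[ℂ] 𝓢(ℝ, ℂ) :=
  SchwartzMap.smulLeftCLM ℂ (fun q : ℝ => (q : ℂ))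

/-- The momentum operator `(h / 2πi) d/dq` with `h = 1 / N`. -/
def momOp (N : ℕ) : 𝓢(ℝ, ℂ) →L[ℂ] 𝓢(ℝ, ℂ) :=
  (1 / (2 * Real.pi * Complex.I * N) : ℂ) • SchwartzMap.derivCLM ℂ ℂ

/-- The Weyl quantization of `H(q, p) = a q² / 2 + b p² / 2 + c q p`. -/
def hamOp (N : ℕ) (a b c : ℝ) : 𝓢(ℝ, ℂ) →L[ℂ] 𝓢(ℝ, ℂ) :=
  (a / 2 : ℂ) • posOp.comp posOp + (b / 2 : ℂ) • (momOp N).comp (momOp N) +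
    (c / 2 : ℂ) • (posOp.comp (momOp N) + (momOp N).comp posOp)

/-- `ψ` solves the Schrödinger equation `(i h / 2π) ∂ψ/∂t = Ĥ ψ`, where the time derivative is
taken in `L²(ℝ)`; that is, `dψ/dt = (2π N / i) Ĥ ψ`. -/
def IsSchrodingerSolution (N : ℕ) (a b c : ℝ) (ψ : ℝ → 𝓢(ℝ, ℂ)) : Prop :=
  ∀ t : ℝ, HasDerivAt (fun s => (ψ s).toLp 2 volume)
    ((2 * Real.pi * N / Complex.I : ℂ) • (hamOp N a b c (ψ t)).toLp 2 volume) t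

/-! ### Existence and uniqueness of solutions of the Schrödinger equation -/

theorem hasTemperateGrowth_coe : (fun q : ℝ => (q : ℂ)).HasTemperateGrowth :=
  Complex.ofRealCLM.hasTemperateGrowth

theorem posOp_apply (f : 𝓢(ℝ, ℂ)) (q : ℝ) : posOp f q = q * f q := by
  simp [posOp, SchwartzMap.smulLeftCLM_apply_apply hasTemperateGrowth_coe]

def chirpFun (s : ℝ) (q : ℝ) : ℂ := Complex.exp (Complex.I * (s * q ^ 2 : ℝ))

theorem chirp_deriv (s q : ℝ) : HasDerivAt (chirpFun s) ((2 * Complex.I * s * q) * chirpFun s q) q := by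
  unfold chirpFun
  have h1 : HasDerivAt (fun q : ℝ => ((s * q ^ 2 : ℝ) : ℂ)) ((s * (2 * q) : ℝ) : ℂ) q := by
    have := ((hasDerivAt_pow 2 q).const_mul s).ofReal_comp
    simpa using this
  have := (h1.const_mul Complex.I).cexp
  convert this using 1
  push_cast; ring

theorem norm_chirp (s q : ℝ) : ‖chirpFun s q‖ = 1 := by
  unfold chirpFun
  rw [mul_comm, Complex.norm_exp_ofReal_mul_I]

theorem chirp_growth (s : ℝ) : (chirpFun s).HasTemperateGrowth := by
  have hexp : (fun x : ℝ => Complex.exp (Complex.I * x)).HasTemperateGrowth := by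
    have hder : ∀ x : ℝ, HasDerivAt (fun x : ℝ => Complex.exp (Complex.I * x))
        (Complex.I * Complex.exp (Complex.I * x)) x := by
      intro x
      have := ((Complex.ofRealCLM.hasDerivAt (x := x)).const_mul Complex.I).cexp
      simpa [mul_comm] using this
    have hit : ∀ n : ℕ, iteratedDeriv n (fun x : ℝ => Complex.exp (Complex.I * x)) =
        fun x : ℝ => Complex.I ^ n * Complex.exp (Complex.I * x) := by
      intro n
      induction n with
      | zero => simp
      | succ n ih =>
        rw [iteratedDeriv_succ, ih]
        ext x
        rw [((hder x).const_mul _).deriv]; ring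
    refine ⟨(contDiff_const.mul Complex.ofRealCLM.contDiff).cexp, fun n => ⟨0, 1, fun x => ?_⟩⟩
    rw [norm_iteratedFDeriv_eq_norm_iteratedDeriv, hit]
    simp [mul_comm Complex.I, Complex.norm_exp_ofReal_mul_I]
  have h2 : (fun q : ℝ => s * q ^ 2).HasTemperateGrowth := by
    have := (Function.HasTemperateGrowth.const (E := ℝ) s).mul
      (Function.HasTemperateGrowth.id (E := ℝ) |>.pow 2)
    exact this
  exact hexp.comp h2

def chirp (s : ℝ) : 𝓢(ℝ, ℂ) →L[ℂ] 𝓢(ℝ, ℂ) := SchwartzMap.smulLeftCLM ℂ (chirpFun s)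

theorem chirp_apply (s : ℝ) (f : 𝓢(ℝ, ℂ)) (q : ℝ) : chirp s f q = chirpFun s q * f q := by
  simp [chirp, SchwartzMap.smulLeftCLM_apply_apply (chirp_growth s)]

theorem chirp_neg_apply (s : ℝ) (f : 𝓢(ℝ, ℂ)) : chirp s (chirp (-s) f) = f := by
  ext q
  rw [chirp_apply, chirp_apply, ← mul_assoc, chirpFun, chirpFun, ← Complex.exp_add]
  simp

theorem posOp_chirp (s : ℝ) (f : 𝓢(ℝ, ℂ)) : posOp (chirp s f) = chirp s (posOp f) := by
  ext q
  simp only [posOp_apply, chirp_apply]; ring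

abbrev dOp : 𝓢(ℝ, ℂ) →L[ℂ] 𝓢(ℝ, ℂ) := SchwartzMap.derivCLM ℂ ℂ

theorem dOp_chirp (s : ℝ) (f : 𝓢(ℝ, ℂ)) :
    dOp (chirp s f) = chirp s (dOp f + (2 * Complex.I * s) • posOp f) := by
  ext q
  have h1 : HasDerivAt (fun x => chirp s f x)
      ((2 * Complex.I * s * q) * chirpFun s q * f q + chirpFun s q * deriv f q) q := by
    have := (chirp_deriv s q).mul (f.hasDerivAt q)
    refine this.congr_of_eventuallyEq (Eventually.of_forall fun x => ?_)
    simp [chirp_apply]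
  rw [SchwartzMap.derivCLM_apply, h1.deriv, chirp_apply]
  simp [posOp_apply]; ring

theorem dOp_posOp (f : 𝓢(ℝ, ℂ)) : dOp (posOp f) = f + posOp (dOp f) := by
  ext q
  have h1 : HasDerivAt (fun x => posOp f x) (1 * f q + (q : ℂ) * deriv f q) q := by
    have := (Complex.ofRealCLM.hasDerivAt (x := q)).mul (f.hasDerivAt q)
    refine (this.congr_of_eventuallyEq (Eventually.of_forall fun x => ?_)).congr_deriv ?_
    · simp [posOp_apply]
    · simp
  rw [SchwartzMap.derivCLM_apply, h1.deriv]
  simp [posOp_apply]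

open LineDeriv in
theorem lineDeriv_one (f : 𝓢(ℝ, ℂ)) : ∂_{(1 : ℝ)} f = dOp f := by
  ext x
  rw [SchwartzMap.lineDerivOp_apply_eq_fderiv, SchwartzMap.derivCLM_apply]
  simp

theorem smulInner_eq (f : 𝓢(ℝ, ℂ)) :
    SchwartzMap.smulLeftCLM ℂ (fun x : ℝ => inner ℝ x (1 : ℝ)) f = posOp f := by
  ext x
  have : (fun x : ℝ => inner ℝ x (1 : ℝ)).HasTemperateGrowth := by fun_prop
  rw [SchwartzMap.smulLeftCLM_apply_apply this, posOp_apply]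
  simp

theorem dOp_fourierInv (f : 𝓢(ℝ, ℂ)) :
    dOp (𝓕⁻ f) = (2 * Real.pi * Complex.I : ℂ) • 𝓕⁻ (posOp f) := by
  have := SchwartzMap.lineDerivOp_fourierInv_eq f (1 : ℝ)
  rw [lineDeriv_one] at this
  rw [this, ← FourierTransform.fourierInv_smul, smulInner_eq]

theorem posOp_fourierInv (f : 𝓢(ℝ, ℂ)) :
    posOp (𝓕⁻ f) = (-(2 * Real.pi * Complex.I : ℂ)⁻¹) • 𝓕⁻ (dOp f) := by
  have := SchwartzMap.fourierInv_lineDerivOp_eq f (1 : ℝ)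
  rw [lineDeriv_one, smulInner_eq] at this
  rw [this, smul_smul]
  have : (2 * Real.pi * Complex.I : ℂ) ≠ 0 := by simp [Real.pi_ne_zero]
  rw [neg_mul_neg, inv_mul_cancel₀ this, one_smul]

def invF : 𝓢(ℝ, ℂ) →L[ℂ] 𝓢(ℝ, ℂ) := FourierTransform.fourierInvCLM ℂ 𝓢(ℝ, ℂ)

theorem invF_apply (f : 𝓢(ℝ, ℂ)) : invF f = 𝓕⁻ f := rfl

def conjOp (s r : ℝ) : 𝓢(ℝ, ℂ) →L[ℂ] 𝓢(ℝ, ℂ) := (chirp s).comp (invF.comp (chirp r))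

def qT (r : ℝ) : 𝓢(ℝ, ℂ) →L[ℂ] 𝓢(ℝ, ℂ) :=
  (-(2 * Real.pi * Complex.I : ℂ)⁻¹) • (dOp + (2 * Complex.I * r : ℂ) • posOp)

def dT (s r : ℝ) : 𝓢(ℝ, ℂ) →L[ℂ] 𝓢(ℝ, ℂ) :=
  (2 * Real.pi * Complex.I : ℂ) • posOp + (2 * Complex.I * s : ℂ) • qT r

theorem posOp_conjOp (s r : ℝ) (f : 𝓢(ℝ, ℂ)) : posOp (conjOp s r f) = conjOp s r (qT r f) := by
  simp only [conjOp, ContinuousLinearMap.comp_apply, posOp_chirp, invF_apply, posOp_fourierInv,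
    dOp_chirp, qT]
  rw [← invF_apply, ← invF_apply]
  simp only [map_smul, smul_apply, add_apply]

theorem dOp_conjOp (s r : ℝ) (f : 𝓢(ℝ, ℂ)) : dOp (conjOp s r f) = conjOp s r (dT s r f) := by
  have h := posOp_conjOp s r f
  simp only [conjOp, ContinuousLinearMap.comp_apply] at h ⊢
  rw [dOp_chirp, map_add, map_smul, ← posOp_chirp, h, invF_apply, dOp_fourierInv, posOp_chirp,
    ← invF_apply]
  simp only [map_smul, map_add, dT, smul_apply, add_apply]

/-- generator of dilations -/
def dilGen : 𝓢(ℝ, ℂ) →L[ℂ] 𝓢(ℝ, ℂ) := (1 / 2 : ℂ) • ContinuousLinearMap.id ℂ _ + posOp.comp dOp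

theorem ham_conjOp {N : ℕ} (hN : 1 ≤ N) {a b c k : ℝ} (hk : b * k ^ 2 + 2 * c * k + a = 0)
    (hm : c + b * k ≠ 0) (f : 𝓢(ℝ, ℂ)) :
    (2 * Real.pi * N / Complex.I : ℂ) • hamOp N a b c
      (conjOp (Real.pi * N * k) (Real.pi * b / (2 * N * (c + b * k))) f) =
    conjOp (Real.pi * N * k) (Real.pi * b / (2 * N * (c + b * k))) (((c + b * k : ℝ) : ℂ) • dilGen f) := by
  have hN' : (N : ℂ) ≠ 0 := by exact_mod_cast (by omega : N ≠ 0)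
  have hpi : (Real.pi : ℂ) ≠ 0 := by exact_mod_cast Real.pi_ne_zero
  have hm' : (c + b * k : ℂ) ≠ 0 := by exact_mod_cast hm
  have hk' : (b * k ^ 2 + 2 * c * k + a : ℂ) = 0 := by exact_mod_cast hk
  simp only [hamOp, momOp, ContinuousLinearMap.comp_apply, smul_apply,
    add_apply, map_smul, posOp_conjOp, dOp_conjOp]
  simp only [← map_smul, ← map_add]
  congr 1
  ext x
  simp only [dT, qT, dilGen, dOp_posOp, ContinuousLinearMap.comp_apply,
    smul_apply, add_apply, map_smul, map_add,
    posOp_apply, smul_eq_mul,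
    ContinuousLinearMap.id_apply]
  generalize dOp (dOp f) x = f2
  generalize dOp f x = f1
  generalize f x = f0
  have ha : (a : ℂ) = -(b * k ^ 2 + 2 * c * k) := by linear_combination hk'
  rw [ha]
  push_cast
  field_simp
  grind [Complex.I_sq]

theorem normSq_toLp (f : 𝓢(ℝ, ℂ)) : ‖f.toLp 2 volume‖ ^ 2 = ∫ x, ‖f x‖ ^ 2 := by
  rw [SchwartzMap.norm_toLp' (by simp) (by simp)]
  have h0 : 0 ≤ ∫ x, ‖f x‖ ^ 2 := integral_nonneg fun _ => by positivity
  simp only [ENNReal.toReal_ofNat, Real.rpow_two]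
  rw [← Real.rpow_natCast, ← Real.rpow_mul h0]
  norm_num

def scaleEquiv (t : ℝ) : ℝ ≃L[ℝ] ℝ :=
  ContinuousLinearEquiv.unitsEquivAut ℝ (Units.mk0 (Real.exp t) (Real.exp_ne_zero t))

def dil (t : ℝ) : 𝓢(ℝ, ℂ) →L[ℂ] 𝓢(ℝ, ℂ) :=
  (Real.exp (t / 2) : ℂ) • SchwartzMap.compCLMOfContinuousLinearEquiv ℂ (scaleEquiv t)

theorem dil_apply (t : ℝ) (f : 𝓢(ℝ, ℂ)) (x : ℝ) :
    dil t f x = Real.exp (t / 2) * f (Real.exp t * x) := by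
  simp [dil, scaleEquiv, mul_comm x]

theorem dil_add (s t : ℝ) (f : 𝓢(ℝ, ℂ)) : dil t (dil s f) = dil (t + s) f := by
  ext x
  simp only [dil_apply]
  rw [← mul_assoc, ← mul_assoc, ← Complex.ofReal_mul, ← Real.exp_add, ← Real.exp_add]
  ring_nf

theorem dil_zero (f : 𝓢(ℝ, ℂ)) : dil 0 f = f := by
  ext x; simp [dil_apply]

theorem norm_dil (t : ℝ) (f : 𝓢(ℝ, ℂ)) : ‖(dil t f).toLp 2 volume‖ = ‖f.toLp 2 volume‖ := by
  rw [← sq_eq_sq₀ (norm_nonneg _) (norm_nonneg _), normSq_toLp, normSq_toLp]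
  have h : ∀ x, ‖dil t f x‖ ^ 2 = Real.exp t * ‖f (Real.exp t * x)‖ ^ 2 := by
    intro x
    rw [dil_apply, norm_mul, mul_pow, Complex.norm_real, Real.norm_eq_abs, sq_abs, ← Real.exp_nat_mul]
    congr 2; push_cast; ring
  simp_rw [h]
  rw [integral_const_mul, Measure.integral_comp_mul_left (fun y => ‖f y‖ ^ 2), smul_eq_mul,
    abs_of_pos (by positivity), mul_inv_cancel_left₀ (Real.exp_ne_zero t)]

theorem norm_chirp_toLp (s : ℝ) (f : 𝓢(ℝ, ℂ)) :
    ‖(chirp s f).toLp 2 volume‖ = ‖f.toLp 2 volume‖ := by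
  rw [← sq_eq_sq₀ (norm_nonneg _) (norm_nonneg _), normSq_toLp, normSq_toLp]
  simp [chirp_apply, norm_chirp]

theorem norm_invF_toLp (f : 𝓢(ℝ, ℂ)) : ‖(invF f).toLp 2 volume‖ = ‖f.toLp 2 volume‖ := by
  rw [invF_apply, ← SchwartzMap.toLp_fourierInv_eq, ← Lp.norm_fourier_eq,
    FourierTransform.fourier_fourierInv_eq]

theorem norm_conjOp_toLp (s r : ℝ) (f : 𝓢(ℝ, ℂ)) :
    ‖(conjOp s r f).toLp 2 volume‖ = ‖f.toLp 2 volume‖ := by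
  simp [conjOp, norm_chirp_toLp, norm_invF_toLp]

theorem toLp_eq (f : 𝓢(ℝ, ℂ)) : f.toLp 2 volume = SchwartzMap.toLpCLM ℂ ℂ 2 volume f := rfl

theorem hasDerivAt_iso {V : 𝓢(ℝ, ℂ) →L[ℂ] 𝓢(ℝ, ℂ)}
    (hV : ∀ f, ‖(V f).toLp 2 volume‖ = ‖f.toLp 2 volume‖) {ψ : ℝ → 𝓢(ℝ, ℂ)} {g : 𝓢(ℝ, ℂ)} {t : ℝ}
    (h : HasDerivAt (fun s => (ψ s).toLp 2 volume) (g.toLp 2 volume) t) :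
    HasDerivAt (fun s => (V (ψ s)).toLp 2 volume) ((V g).toLp 2 volume) t := by
  rw [hasDerivAt_iff_tendsto] at h ⊢
  refine h.congr fun s => ?_
  congr 1
  have := hV (ψ s - ψ t - ((s - t : ℝ) : ℂ) • g)
  simp only [toLp_eq, map_sub, map_smul] at this ⊢
  exact this.symm

theorem decay_bound (g : 𝓢(ℝ, ℂ)) : ∃ C, 0 < C ∧ ∀ y, ‖g y‖ ≤ C / (1 + y ^ 2) := by
  obtain ⟨C0, h0, hC0⟩ := g.decay 0 0
  obtain ⟨C2, h2, hC2⟩ := g.decay 2 0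
  refine ⟨C0 + C2, by positivity, fun y => ?_⟩
  rw [le_div_iff₀ (by positivity)]
  have e0 := hC0 y
  have e2 := hC2 y
  simp at e0 e2
  nlinarith

theorem dil_bound (g : 𝓢(ℝ, ℂ)) :
    ∃ C, 0 < C ∧ ∀ t, |t| ≤ 1 → ∀ x, ‖dil t g x‖ ≤ C / (1 + x ^ 2) := by
  obtain ⟨C, hC, hg⟩ := decay_bound g
  refine ⟨Real.exp 1 * (C * Real.exp 2), by positivity, fun t ht x => ?_⟩
  rw [dil_apply, norm_mul, Complex.norm_real, Real.norm_of_nonneg (Real.exp_pos _).le, mul_div_assoc]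
  obtain ⟨h1, h2⟩ := abs_le.mp ht
  refine mul_le_mul (Real.exp_le_exp.2 (by linarith)) ((hg _).trans ?_) (norm_nonneg _) (by positivity)
  rw [div_le_div_iff₀ (by positivity) (by positivity), mul_assoc]
  refine mul_le_mul_of_nonneg_left ?_ hC.le
  have e : 1 ≤ Real.exp 2 := Real.one_le_exp (by norm_num)
  have e' : 1 ≤ Real.exp 2 * Real.exp t ^ 2 := by
    rw [← Real.exp_nat_mul, ← Real.exp_add]
    exact Real.one_le_exp (by push_cast; linarith)
  nlinarith [mul_le_mul_of_nonneg_right e' (sq_nonneg x)]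

theorem dil_pointwise (f : 𝓢(ℝ, ℂ)) (x t : ℝ) :
    HasDerivAt (fun s => dil s f x) (dil t (dilGen f) x) t := by
  simp only [dil_apply]
  have h1 : HasDerivAt (fun s : ℝ => ((Real.exp (s / 2) : ℝ) : ℂ)) ((Real.exp (t / 2) * (1 / 2) : ℝ) : ℂ) t :=
    (((hasDerivAt_id t).div_const 2).exp).ofReal_comp
  have h2 : HasDerivAt (fun s : ℝ => f (Real.exp s * x)) ((Real.exp t * x) • deriv f (Real.exp t * x)) t :=
    HasDerivAt.scomp t (f.hasDerivAt _) ((Real.hasDerivAt_exp t).mul_const x)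
  refine (h1.mul h2).congr_deriv ?_
  simp [dilGen, posOp_apply]
  ring

theorem dil_hasDerivAt_zero (f : 𝓢(ℝ, ℂ)) :
    HasDerivAt (fun s => (dil s f).toLp 2 volume) ((dilGen f).toLp 2 volume) 0 := by
  obtain ⟨C, hC, hb⟩ := dil_bound (dilGen f)
  have key : ∀ s, |s| ≤ 1 → ∀ x, ‖dil s f x - f x - s * dilGen f x‖ ≤ |s| * (2 * C / (1 + x ^ 2)) := by
    intro s hs x
    have := Convex.norm_image_sub_le_of_norm_hasDerivWithin_le
      (f := fun τ : ℝ => dil τ f x - τ * dilGen f x)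
      (f' := fun τ => dil τ (dilGen f) x - dilGen f x) (s := Set.Icc (-1) 1) (x := 0) (y := s)
      (C := 2 * C / (1 + x ^ 2)) (fun τ _ => ?_) (fun τ hτ => ?_) (convex_Icc _ _) (by simp)
      (abs_le.mp hs)
    · simp only [dil_zero, Complex.ofReal_zero, zero_mul, sub_zero, Real.norm_eq_abs] at this
      rw [mul_comm |s|]
      have e : dil s f x - f x - s * dilGen f x = dil s f x - s * dilGen f x - f x := by ring
      rw [e]
      exact this
    · have h3 : HasDerivAt (fun τ : ℝ => (τ : ℂ) * dilGen f x) (dilGen f x) τ := by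
        simpa using (Complex.ofRealCLM.hasDerivAt (x := τ)).mul_const (dilGen f x)
      exact ((dil_pointwise f x τ).sub h3).hasDerivWithinAt
    · refine (norm_sub_le _ _).trans ?_
      have e1 := hb τ (abs_le.mpr hτ) x
      have e2 := hb 0 (by simp) x
      rw [dil_zero] at e2
      have : 2 * C / (1 + x ^ 2) = C / (1 + x ^ 2) + C / (1 + x ^ 2) := by ring
      linarith
  rw [hasDerivAt_iff_tendsto]
  have hsq : ∀ s : ℝ, (‖s - 0‖⁻¹ * ‖(dil s f).toLp 2 volume - (dil 0 f).toLp 2 volume -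
      (s - 0) • (dilGen f).toLp 2 volume‖) ^ 2 =
      ∫ x, (|s|⁻¹ * ‖dil s f x - f x - s * dilGen f x‖) ^ 2 := by
    intro s
    have := normSq_toLp (dil s f - f - (s : ℂ) • dilGen f)
    simp only [toLp_eq, map_sub, map_smul] at this ⊢
    rw [mul_pow, sub_zero, dil_zero, Real.norm_eq_abs]
    have e : (s • (SchwartzMap.toLpCLM ℂ ℂ 2 volume) (dilGen f)) =
      ((s : ℂ) • (SchwartzMap.toLpCLM ℂ ℂ 2 volume) (dilGen f)) := rfl
    rw [e, this, ← integral_const_mul]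
    simp [mul_pow]
  have hlim : Tendsto (fun s : ℝ => ∫ x, (|s|⁻¹ * ‖dil s f x - f x - s * dilGen f x‖) ^ 2)
      (𝓝 0) (𝓝 (∫ x : ℝ, (0 : ℝ))) := by
    refine tendsto_integral_filter_of_dominated_convergence (fun x => (2 * C) ^ 2 * (1 + x ^ 2)⁻¹) ?_ ?_ ?_ ?_
    · refine Eventually.of_forall fun s => Continuous.aestronglyMeasurable ?_
      have := (dil s f).continuous
      have := f.continuous
      have := (dilGen f).continuous
      fun_prop
    · have : ∀ᶠ s : ℝ in 𝓝 0, |s| ≤ 1 := by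
        filter_upwards [Metric.closedBall_mem_nhds (0 : ℝ) one_pos] with s hs
        simpa using hs
      filter_upwards [this] with s hs
      refine Eventually.of_forall fun x => ?_
      have h1 : |s|⁻¹ * ‖dil s f x - f x - s * dilGen f x‖ ≤ 2 * C / (1 + x ^ 2) := by
        refine (mul_le_mul_of_nonneg_left (key s hs x) (by positivity)).trans ?_
        rw [← mul_assoc]
        refine mul_le_of_le_one_left (by positivity) inv_mul_le_one
      rw [Real.norm_of_nonneg (by positivity)]
      refine (pow_le_pow_left₀ (by positivity) h1 2).trans ?_
      rw [div_pow, div_eq_mul_inv]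
      refine mul_le_mul_of_nonneg_left ?_ (by positivity)
      refine inv_anti₀ (by positivity) ?_
      nlinarith [sq_nonneg x]
    · exact integrable_inv_one_add_sq.const_mul _
    · refine Eventually.of_forall fun x => ?_
      have := hasDerivAt_iff_tendsto.mp (dil_pointwise f x 0)
      have := this.pow 2
      simpa [dil_zero] using this
  simp only [integral_zero] at hlim
  have := (hlim.congr fun s => (hsq s).symm).sqrt
  simp only [Real.sqrt_zero] at this
  refine this.congr fun s => Real.sqrt_sq (by positivity)

theorem dil_hasDerivAt (f : 𝓢(ℝ, ℂ)) (t : ℝ) :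
    HasDerivAt (fun s => (dil s f).toLp 2 volume) ((dil t (dilGen f)).toLp 2 volume) t := by
  have h := hasDerivAt_iso (norm_dil t) (dil_hasDerivAt_zero f)
  have h2 := HasDerivAt.comp_sub_const t t (by simpa using h)
  refine h2.congr_of_eventuallyEq (Eventually.of_forall fun s => ?_)
  simp [dil_add]

theorem dil_gen_comm (f : 𝓢(ℝ, ℂ)) (t : ℝ) : dil t (dilGen f) = dilGen (dil t f) := by
  ext x
  have h : HasDerivAt (fun y => dil t f y) (Real.exp (t / 2) * (Real.exp t • deriv f (Real.exp t * x))) x := by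
    simp only [dil_apply]
    refine HasDerivAt.const_mul _ ?_
    have := HasDerivAt.scomp x (f.hasDerivAt _) ((hasDerivAt_id x).const_mul (Real.exp t))
    simpa [Function.comp_def] using this
  simp only [dilGen, add_apply, smul_apply, ContinuousLinearMap.comp_apply, posOp_apply, dil_apply,
    ContinuousLinearMap.id_apply, SchwartzMap.derivCLM_apply]
  rw [h.deriv]
  simp
  ring

theorem exists_schrodingerSolution {N : ℕ} (hN : 1 ≤ N) {a b c : ℝ} (hyp : a * b < c ^ 2)
    (f : 𝓢(ℝ, ℂ)) : ∃ ψ, IsSchrodingerSolution N a b c ψ ∧ ψ 0 = f := by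
  obtain ⟨k, hk, hm⟩ : ∃ k, b * k ^ 2 + 2 * c * k + a = 0 ∧ c + b * k ≠ 0 := by
    by_cases hb : b = 0
    · subst hb
      have hc : c ≠ 0 := by rintro rfl; simp at hyp
      exact ⟨-a / (2 * c), by field_simp; ring, by simpa using hc⟩
    · have hs : √(c ^ 2 - a * b) ^ 2 = c ^ 2 - a * b := Real.sq_sqrt (by linarith)
      have hpos : 0 < √(c ^ 2 - a * b) := Real.sqrt_pos.2 (by linarith)
      refine ⟨(√(c ^ 2 - a * b) - c) / b, ?_, ?_⟩
      · field_simp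
        rw [mul_comm b a]
        linear_combination hs
      · rw [mul_div_cancel₀ _ hb]
        simpa using hpos.ne'
  set m := c + b * k
  set s := Real.pi * N * k
  set r := Real.pi * b / (2 * N * m)
  have hinv : conjOp s r (chirp (-r) (𝓕 (chirp (-s) f))) = f := by
    simp only [conjOp, ContinuousLinearMap.comp_apply, chirp_neg_apply, invF_apply,
      FourierTransform.fourierInv_fourier_eq]
  set g := chirp (-r) (𝓕 (chirp (-s) f))
  refine ⟨fun t => conjOp s r (dil (m * t) g), fun t => ?_, by simp [dil_zero, hinv]⟩
  have h1 : HasDerivAt (fun t => (dil (m * t) g).toLp 2 volume)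
      (((m : ℂ) • dil (m * t) (dilGen g)).toLp 2 volume) t :=
    HasDerivAt.scomp t (dil_hasDerivAt g (m * t)) (((hasDerivAt_id t).const_mul m).congr_deriv (mul_one m))
  have h2 := hasDerivAt_iso (norm_conjOp_toLp s r) h1
  have h3 := ham_conjOp hN hk hm (dil (m * t) g)
  refine h2.congr_deriv ?_
  rw [dil_gen_comm, ← h3]
  rfl

theorem inner_posOp (f g : 𝓢(ℝ, ℂ)) : inner ℂ (SchwartzMap.toLp (posOp f) 2 (volume : Measure ℝ))
      (SchwartzMap.toLp g 2 (volume : Measure ℝ)) = inner ℂ (SchwartzMap.toLp f 2 (volume : Measure ℝ))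
      (SchwartzMap.toLp (posOp g) 2 (volume : Measure ℝ)) := by
  simp only [SchwartzMap.inner_toL2_toL2_eq]
  congr 1
  ext x
  simp [posOp_apply]
  ring

theorem inner_dOp (f g : 𝓢(ℝ, ℂ)) : inner ℂ (SchwartzMap.toLp f 2 (volume : Measure ℝ))
      (SchwartzMap.toLp (dOp g) 2 (volume : Measure ℝ)) = -inner ℂ (SchwartzMap.toLp (dOp f) 2 (volume : Measure ℝ))
      (SchwartzMap.toLp g 2 (volume : Measure ℝ)) := by
  simp only [SchwartzMap.inner_toL2_toL2_eq]
  have := SchwartzMap.integral_bilinear_deriv_right_eq_neg_left f g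
    ((ContinuousLinearMap.mul ℝ ℂ).comp (Complex.conjCLE : ℂ →L[ℝ] ℂ))
  simpa [mul_comm] using this

theorem conj_two : conj (2 : ℂ) = 2 := map_ofNat _ 2

theorem inner_momOp (N : ℕ) (f g : 𝓢(ℝ, ℂ)) : inner ℂ (SchwartzMap.toLp (momOp N f) 2 (volume : Measure ℝ))
      (SchwartzMap.toLp g 2 (volume : Measure ℝ)) = inner ℂ (SchwartzMap.toLp f 2 (volume : Measure ℝ))
      (SchwartzMap.toLp (momOp N g) 2 (volume : Measure ℝ)) := by
  have h := inner_dOp f g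
  simp only [momOp, smul_apply, toLp_eq, map_smul, inner_smul_left, inner_smul_right] at h ⊢
  rw [h]
  simp [conj_two]

theorem inner_hamOp (N : ℕ) (a b c : ℝ) (f g : 𝓢(ℝ, ℂ)) :
    inner ℂ (SchwartzMap.toLp (hamOp N a b c f) 2 (volume : Measure ℝ))
      (SchwartzMap.toLp g 2 (volume : Measure ℝ)) = inner ℂ (SchwartzMap.toLp f 2 (volume : Measure ℝ))
      (SchwartzMap.toLp (hamOp N a b c g) 2 (volume : Measure ℝ)) := by
  have e1 := fun f g => inner_posOp f g
  have e2 := fun f g => inner_momOp N f g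
  simp only [toLp_eq] at e1 e2 ⊢
  simp only [hamOp, add_apply, smul_apply, ContinuousLinearMap.comp_apply, map_add, map_smul,
    inner_add_left, inner_add_right, inner_smul_left, inner_smul_right, e1, e2]
  simp only [map_div₀, Complex.conj_ofReal, conj_two]
  ring

theorem schrodingerSolution_unique {N : ℕ} {a b c : ℝ} {ψ χ : ℝ → 𝓢(ℝ, ℂ)}
    (hψ : IsSchrodingerSolution N a b c ψ) (hχ : IsSchrodingerSolution N a b c χ)
    (h0 : ψ 0 = χ 0) : ψ = χ := by
  let w : ℝ → 𝓢(ℝ, ℂ) := fun t => ψ t - χ t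
  have hw : ∀ t, HasDerivAt (fun s => (w s).toLp 2 volume)
      ((2 * Real.pi * N / Complex.I : ℂ) • (hamOp N a b c (w t)).toLp 2 volume) t := by
    intro t
    have := (hψ t).sub (hχ t)
    simp only [w, toLp_eq, map_sub, smul_sub] at this ⊢
    exact this
  have hd : ∀ t, HasDerivAt (fun s => inner ℂ (SchwartzMap.toLp (w s) 2 (volume : Measure ℝ))
      (SchwartzMap.toLp (w s) 2 (volume : Measure ℝ))) 0 t := by
    intro t
    refine ((hw t).inner ℂ (hw t)).congr_deriv ?_
    rw [inner_smul_left, inner_smul_right, inner_hamOp]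
    simp [conj_two]
  funext t
  have hc := is_const_of_deriv_eq_zero (fun t => (hd t).differentiableAt) (fun t => (hd t).deriv) t 0
  have hw0 : w 0 = 0 := by simp [w, h0]
  rw [hw0] at hc
  have hz : ((0 : 𝓢(ℝ, ℂ)).toLp 2 volume) = 0 := map_zero (SchwartzMap.toLpCLM ℂ ℂ 2 volume)
  rw [hz, inner_zero_left, inner_self_eq_zero, ← hz] at hc
  exact sub_eq_zero.mp (SchwartzMap.injective_toLp 2 volume hc)

/-! ### The quantum cat map -/

/-- The Schrödinger flow at time one, `e^{-2πi Ĥ / h}` with `h = 1 / N`, on Schwartz functions: it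
sends `f` to `ψ(1)`, where `ψ` is the solution of the Schrödinger equation with `ψ(0) = f`. For
`N ≥ 1` and `a b < c²` the solution exists and is unique (see `exists_schrodingerSolution` and
`schrodingerSolution_unique`); the value `0` in the other case is a placeholder. -/
def propagator (N : ℕ) (a b c : ℝ) (f : 𝓢(ℝ, ℂ)) : 𝓢(ℝ, ℂ) :=
  open Classical in
  if h : ∃ ψ, IsSchrodingerSolution N a b c ψ ∧ ψ 0 = f then h.choose 1 else 0

theorem propagator_eq {N : ℕ} {a b c : ℝ} {ψ : ℝ → 𝓢(ℝ, ℂ)}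
    (hψ : IsSchrodingerSolution N a b c ψ) : propagator N a b c (ψ 0) = ψ 1 := by
  have h : ∃ χ, IsSchrodingerSolution N a b c χ ∧ χ 0 = ψ 0 := ⟨ψ, hψ, rfl⟩
  rw [propagator, dif_pos h]
  rw [schrodingerSolution_unique h.choose_spec.1 hψ h.choose_spec.2]

/-- `M = ± exp X`, where `X` generates the classical flow `q' = b p + c q`, `p' = -a q - c p` of the
hyperbolic quadratic Hamiltonian `H(q, p) = a q² / 2 + b p² / 2 + c q p`. The sign `ε` is that of
the trace of `M`. -/
structure IsGenerator (M : Matrix.SpecialLinearGroup (Fin 2) ℤ) (ε : ℤˣ) (a b c : ℝ) : Prop where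
  hyperbolic : a * b < c ^ 2
  eq_exp : (M : Matrix (Fin 2) (Fin 2) ℤ).map (Int.cast : ℤ → ℝ) =
    ((ε : ℤ) : ℝ) • NormedSpace.exp (!![c, b; -a, -c] : Matrix (Fin 2) (Fin 2) ℝ)

/-- The quantization on Schwartz functions of `ε exp X`: the Schrödinger flow at time one, followed
for `ε = -1` by the quantization `f(q) ↦ f(-q)` of minus the identity. -/
def quantization (N : ℕ) (ε : ℤˣ) (a b c : ℝ) (f : 𝓢(ℝ, ℂ)) : 𝓢(ℝ, ℂ) :=
  if ε = 1 then propagator N a b c f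
  else SchwartzMap.compCLMOfContinuousLinearEquiv ℂ (ContinuousLinearEquiv.neg ℝ)
    (propagator N a b c f)

/-! ### Quantum states on the torus -/

/-- The space `H_{N,κ}` of quantum states. The sequence `Ψ` stands for the distribution
`∑ₖ Ψ(k) δ(q - (k + κ₁) / N)`, with `Ψ(k + N) = exp(-2πi κ₂) Ψ(k)`. -/
def torusStates (N : ℕ) (κ : ℝ × ℝ) : Submodule ℂ (ℤ → ℂ) where
  carrier := {Ψ | ∀ k, Ψ (k + N) = Complex.exp (-(2 * Real.pi * Complex.I * κ.2)) * Ψ k}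
  add_mem' h₁ h₂ k := by simp [h₁ k, h₂ k, mul_add]
  zero_mem' k := by simp
  smul_mem' z Ψ h k := by
    simp only [Set.mem_ofPred_eq] at h
    simp only [Pi.smul_apply, h k, smul_eq_mul]
    ring

/-- The inner product `⟨Ψ, Φ⟩ = N⁻¹ ∑_{1 ≤ k ≤ N} Ψ(k) conj(Φ(k))` of `H_{N,κ}`. -/
def stateInner (N : ℕ) (Ψ Φ : ℤ → ℂ) : ℂ :=
  (1 / N : ℂ) * ∑ k ∈ Finset.Icc 1 N, Ψ k * conj (Φ k)

/-- The value at `conj f` of the distribution `∑ₖ Ψ(k) δ(q - (k + κ₁) / N)`, that is, its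
(sesquilinear) pairing `⟨ψ, f⟩` with the Schwartz function `f`. -/
def pairing (N : ℕ) (κ : ℝ × ℝ) (Ψ : ℤ → ℂ) (f : 𝓢(ℝ, ℂ)) : ℂ :=
  ∑' k : ℤ, Ψ k * conj (f ((k + κ.1) / N))

/-- `Φ = M̂ Ψ` as distributions. The unitary operator `M̂`, a bijection of the Schwartz space, acts on
distributions by duality: `⟨M̂ ψ, M̂ f⟩ = ⟨ψ, f⟩` for all Schwartz functions `f`. -/
def IsImage (N : ℕ) (ε : ℤˣ) (a b c : ℝ) (κ : ℝ × ℝ) (Ψ Φ : ℤ → ℂ) : Prop :=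
  ∀ f : 𝓢(ℝ, ℂ), pairing N κ Φ (quantization N ε a b c f) = pairing N κ Ψ f

/-- `M̂` maps `H_{N,κ}` to itself. -/
def PreservesStates (N : ℕ) (ε : ℤˣ) (a b c : ℝ) (κ : ℝ × ℝ) : Prop :=
  ∀ Ψ ∈ torusStates N κ, ∃ Φ ∈ torusStates N κ, IsImage N ε a b c κ Ψ Φ

/-- `φ` is an orthonormal basis of the `N`-dimensional space `H_{N,κ}` that consists of
eigenstates of the quantum cat map `M̂`. -/
structure IsEigenbasis (N : ℕ) (ε : ℤˣ) (a b c : ℝ) (κ : ℝ × ℝ) (φ : Fin N → ℤ → ℂ) : Prop where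
  mem : ∀ j, φ j ∈ torusStates N κ
  orthonormal : ∀ i j, stateInner N (φ i) (φ j) = if i = j then 1 else 0
  eigen : ∀ j, ∃ θ : ℝ, IsImage N ε a b c κ (φ j) (Complex.exp (Complex.I * θ) • φ j)

/-- The position density `|ψ|² dVol` of a state, as a measure on `T¹ = ℝ / ℤ`: mass `|Ψ(k)|² / N` at
the point `(k + κ₁) / N`, for `1 ≤ k ≤ N`. A normalized state has total mass one. -/
def positionMeasure (N : ℕ) (κ : ℝ × ℝ) (Ψ : ℤ → ℂ) : Measure UnitAddCircle :=
  ∑ k ∈ Finset.Icc 1 N, ENNReal.ofReal (‖Ψ k‖ ^ 2 / N) •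
    Measure.dirac ((((k : ℝ) + κ.1) / N : ℝ) : UnitAddCircle)

end QuantumCat

end

noncomputable section

namespace QuantumCat

/-! ### Weyl operators and the exact Egorov property -/

/-! The proof is a quantum variance estimate with a logarithmic gain, followed by Fourier analysis
on the circle at scale `r`.

Since the Hamiltonian is quadratic, Egorov's theorem is exact: conjugation by the quantized map
sends the Weyl operator of `v` to that of `M v` (`intertwines_quantization`). Weyl operators of
vectors in `ℤ² / N` act on torus states, so for an eigenstate the matrix coefficient of the Weyl
operator of `w / N` does not change along the orbit `w, M w, M² w, ...`
(`stateInner_shiftOp_mulVec`). The `n`-th Fourier coefficient of the position density is the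
coefficient at `w = (0, n)`, hence it equals its own average over times `0, ..., T`.

Weyl operators whose position shifts differ modulo `N` are orthogonal in the Hilbert–Schmidt sense,
so the squared coefficients, summed over the basis, are at most `N / (T + 1)`
(`sum_norm_sq_stateInner_le`). Hyperbolicity makes the first coordinates of the orbit of `(0, n)`
grow strictly in absolute value and at most exponentially. For `n ≤ √N` they stay distinct modulo
`N` up to a time `T` of order `log N`, which gives a variance `O(N / log N)`
(`sum_norm_sq_densityCoeff_le`).

Trapezoids sandwich the indicator of a ball of radius `r`. Their coefficients are bounded, up to a
constant, by `min r (1 / (r n²))`, whose sum over `n` is bounded uniformly in `r` (`sum_min_le`).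
Thus one weighted sum of moduli, independent of the centre, controls all balls, and its mean over
the basis is `O((log N)^(-1/2))`. As `α < 1/2`, this is much smaller than `r`, and Markov's
inequality removes a vanishing proportion of the states. -/

theorem affinePhase_hasTemperateGrowth (u v : ℝ) :
    (fun q : ℝ => Complex.exp (Complex.I * (u * q + v : ℝ))).HasTemperateGrowth := by
  have hder : ∀ x : ℝ, HasDerivAt (fun q : ℝ => Complex.exp (Complex.I * (u * q + v : ℝ)))
      (Complex.I * u * Complex.exp (Complex.I * (u * x + v : ℝ))) x := by
    intro x
    have h1 : HasDerivAt (fun q : ℝ => ((u * q + v : ℝ) : ℂ)) (u : ℂ) x := by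
      simpa using (((hasDerivAt_id x).const_mul u).add_const v).ofReal_comp
    refine ((h1.const_mul Complex.I).cexp).congr_deriv ?_
    ring
  have hit : ∀ n : ℕ, iteratedDeriv n (fun q : ℝ => Complex.exp (Complex.I * (u * q + v : ℝ))) =
      fun q : ℝ => (Complex.I * u) ^ n * Complex.exp (Complex.I * (u * q + v : ℝ)) := by
    intro n
    induction n with
    | zero => simp
    | succ n ih =>
      rw [iteratedDeriv_succ, ih]
      ext x
      rw [((hder x).const_mul _).deriv]; ring
  refine ⟨?_, fun n => ⟨0, |u| ^ n, fun x => ?_⟩⟩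
  · have : ContDiff ℝ ((⊤ : ℕ∞) : WithTop ℕ∞) (fun q : ℝ => u * q + v) := by fun_prop
    exact (contDiff_const.mul (Complex.ofRealCLM.contDiff.comp this)).cexp
  · rw [norm_iteratedFDeriv_eq_norm_iteratedDeriv, hit]
    rw [norm_mul, mul_comm Complex.I ((u * x + v : ℝ) : ℂ), Complex.norm_exp_ofReal_mul_I]
    simp

/-- The Weyl operator of the phase space translation by `v = (x, ξ)`, with Planck constant `1 / N`:
`f(q) ↦ exp(πi N ξ (2 q - x)) f(q - x)`. -/
def weyl (N : ℕ) (v : Fin 2 → ℝ) : 𝓢(ℝ, ℂ) →L[ℂ] 𝓢(ℝ, ℂ) :=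
  (SchwartzMap.smulLeftCLM ℂ (fun q : ℝ => Complex.exp (Complex.I *
    (2 * Real.pi * N * v 1 * q + -(Real.pi * N * v 0 * v 1) : ℝ)))).comp
    (SchwartzMap.compSubConstCLM ℂ (v 0))

theorem weyl_apply (N : ℕ) (v : Fin 2 → ℝ) (f : 𝓢(ℝ, ℂ)) (q : ℝ) :
    weyl N v f q = Complex.exp (Complex.I *
      (2 * Real.pi * N * v 1 * q + -(Real.pi * N * v 0 * v 1) : ℝ)) * f (q - v 0) := by
  simp only [weyl, ContinuousLinearMap.comp_apply]
  rw [SchwartzMap.smulLeftCLM_apply_apply (affinePhase_hasTemperateGrowth _ _)]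
  simp

/-- The map `Q` quantizes the linear map `A`: conjugation by `Q` acts on Weyl operators as `A`. -/
def Intertwines (N : ℕ) (Q : 𝓢(ℝ, ℂ) → 𝓢(ℝ, ℂ)) (A : Matrix (Fin 2) (Fin 2) ℝ) : Prop :=
  ∀ v f, Q (weyl N v f) = weyl N (A.mulVec v) (Q f)

theorem Intertwines.comp {N : ℕ} {Q R : 𝓢(ℝ, ℂ) → 𝓢(ℝ, ℂ)} {A B : Matrix (Fin 2) (Fin 2) ℝ}
    (hQ : Intertwines N Q A) (hR : Intertwines N R B) : Intertwines N (Q ∘ R) (A * B) := by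
  intro v f
  simp only [Function.comp_apply]
  rw [hR, hQ, Matrix.mulVec_mulVec]

theorem Intertwines.inverse {N : ℕ} {Q R : 𝓢(ℝ, ℂ) → 𝓢(ℝ, ℂ)} {A B : Matrix (Fin 2) (Fin 2) ℝ}
    (hQ : Intertwines N Q A) (hRQ : ∀ f, R (Q f) = f) (hQR : ∀ f, Q (R f) = f) (hAB : A * B = 1) :
    Intertwines N R B := by
  intro v f
  have := hQ (B.mulVec v) (R f)
  rw [Matrix.mulVec_mulVec, hAB, Matrix.one_mulVec, hQR] at this
  rw [← this, hRQ]

/-- The phase difference `s q² - s (q - x)² = s x (2 q - x)` is exactly the Weyl phase of momentum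
`s x / (π N)`. The symmetric normalization of `weyl` leaves no scalar factor over. -/
theorem intertwines_chirp {N : ℕ} (hN : N ≠ 0) (s : ℝ) :
    Intertwines N (chirp s) !![1, 0; s / (Real.pi * N), 1] := by
  intro v f
  ext q
  simp only [chirp_apply, weyl_apply, chirpFun, Matrix.mulVec, dotProduct, Fin.sum_univ_two,
    Matrix.of_apply, Matrix.cons_val', Matrix.cons_val_zero, Matrix.cons_val_one,
    Matrix.cons_val_fin_one]
  simp only [one_mul, zero_mul, add_zero]
  rw [← mul_assoc, ← mul_assoc, ← Complex.exp_add, ← Complex.exp_add]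
  have hN' : (N : ℝ) ≠ 0 := by exact_mod_cast hN
  rw [← mul_add, ← mul_add, ← Complex.ofReal_add, ← Complex.ofReal_add]
  congr 4
  field_simp
  ring

/-- The Fourier transform exchanges translations and modulations. The entries `N` and `1 / N` appear
because it is not rescaled to Planck constant `1 / N`. -/
theorem intertwines_invF {N : ℕ} (hN : N ≠ 0) :
    Intertwines N invF !![0, -(N : ℝ); 1 / N, 0] := by
  intro v f
  have hN' : (N : ℝ) ≠ 0 := by exact_mod_cast hN
  ext q
  simp only [weyl_apply, Matrix.mulVec, dotProduct, Fin.sum_univ_two, Matrix.of_apply,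
    Matrix.cons_val', Matrix.cons_val_zero, Matrix.cons_val_one, Matrix.cons_val_fin_one,
    invF_apply, SchwartzMap.fourierInv_coe, Real.fourierInv_eq', zero_mul, zero_add, add_zero]
  -- The substitution `y ↦ y + v 0` undoes the translation, after which the two integrands agree
  -- phase by phase.
  rw [← integral_const_mul, ← integral_add_right_eq_self _ (v 0)]
  congr 1
  ext y
  simp only [add_sub_cancel_right, smul_eq_mul, inner, ← mul_assoc]
  rw [← Complex.exp_add, ← Complex.exp_add]
  congr 2
  have hN'' : (N : ℂ) ≠ 0 := by exact_mod_cast hN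
  push_cast
  simp
  field_simp
  ring

theorem intertwines_dil {N : ℕ} (t : ℝ) :
    Intertwines N (dil t) (Matrix.diagonal ![Real.exp (-t), Real.exp t]) := by
  intro v f
  ext q
  simp only [dil_apply, weyl_apply, Matrix.mulVec_diagonal, Matrix.cons_val_zero,
    Matrix.cons_val_one, Matrix.cons_val_fin_one]
  have h : Real.exp t * Real.exp (-t) = 1 := by rw [← Real.exp_add]; simp
  have e1 : Real.exp t * (q - Real.exp (-t) * v 0) = Real.exp t * q - v 0 := by
    rw [mul_sub, ← mul_assoc, h, one_mul]
  have e2 : Real.pi * N * (Real.exp (-t) * v 0) * (Real.exp t * v 1) = Real.pi * N * v 0 * v 1 := by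
    linear_combination (Real.pi * N * v 0 * v 1) * h
  have e3 : 2 * Real.pi * N * (Real.exp t * v 1) * q = 2 * Real.pi * N * v 1 * (Real.exp t * q) := by
    ring
  rw [e1, e2, e3]
  ring

theorem intertwines_reflection {N : ℕ} :
    Intertwines N (SchwartzMap.compCLMOfContinuousLinearEquiv ℂ (ContinuousLinearEquiv.neg ℝ))
      (-1) := by
  intro v f
  ext q
  simp only [SchwartzMap.compCLMOfContinuousLinearEquiv_apply, Function.comp_apply, weyl_apply,
    ContinuousLinearEquiv.coe_neg, Matrix.neg_mulVec, Matrix.one_mulVec, Pi.neg_apply, id]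
  congr 1
  · congr 3
    ring
  · congr 1
    ring

/-! ### The propagator as a conjugated dilation -/

def conjOpInv (s r : ℝ) (f : 𝓢(ℝ, ℂ)) : 𝓢(ℝ, ℂ) := chirp (-r) (𝓕 (chirp (-s) f))

theorem conjOp_conjOpInv (s r : ℝ) (f : 𝓢(ℝ, ℂ)) : conjOp s r (conjOpInv s r f) = f := by
  simp only [conjOp, conjOpInv, ContinuousLinearMap.comp_apply, chirp_neg_apply, invF_apply,
    FourierTransform.fourierInv_fourier_eq]

theorem conjOpInv_conjOp (s r : ℝ) (f : 𝓢(ℝ, ℂ)) : conjOpInv s r (conjOp s r f) = f := by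
  have h : ∀ (t : ℝ) (g : 𝓢(ℝ, ℂ)), chirp (-t) (chirp t g) = g := fun t g => by
    simpa using chirp_neg_apply (-t) g
  simp only [conjOp, conjOpInv, ContinuousLinearMap.comp_apply, h, invF_apply,
    FourierTransform.fourier_fourierInv_eq]

theorem intertwines_conjOp {N : ℕ} (hN : N ≠ 0) (s r : ℝ) :
    Intertwines N (conjOp s r) (!![1, 0; s / (Real.pi * N), 1] *
      (!![0, -(N : ℝ); 1 / N, 0] * !![1, 0; r / (Real.pi * N), 1])) :=
  (intertwines_chirp hN s).comp ((intertwines_invF hN).comp (intertwines_chirp hN r))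

/-- The line `p = k q` is invariant under the classical flow, with rate `c + b k`. Such a line
exists, with nonzero rate, because the eigenvalues `± √(c² - a b)` of the generator are real and
nonzero. -/
theorem exists_slope {a b c : ℝ} (hyp : a * b < c ^ 2) :
    ∃ k, b * k ^ 2 + 2 * c * k + a = 0 ∧ c + b * k ≠ 0 := by
  by_cases hb : b = 0
  · subst hb
    have hc : c ≠ 0 := by rintro rfl; simp at hyp
    exact ⟨-a / (2 * c), by field_simp; ring, by simpa using hc⟩
  · have hs : √(c ^ 2 - a * b) ^ 2 = c ^ 2 - a * b := Real.sq_sqrt (by linarith)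
    have hpos : 0 < √(c ^ 2 - a * b) := Real.sqrt_pos.2 (by linarith)
    refine ⟨(√(c ^ 2 - a * b) - c) / b, ?_, ?_⟩
    · field_simp
      rw [mul_comm b a]
      linear_combination hs
    · rw [mul_div_cancel₀ _ hb]
      simpa using hpos.ne'

theorem propagator_eq_conj {N : ℕ} (hN : 1 ≤ N) {a b c k : ℝ}
    (hk : b * k ^ 2 + 2 * c * k + a = 0) (hm : c + b * k ≠ 0) (f : 𝓢(ℝ, ℂ)) :
    propagator N a b c f = conjOp (Real.pi * N * k) (Real.pi * b / (2 * N * (c + b * k)))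
      (dil (c + b * k) (conjOpInv (Real.pi * N * k) (Real.pi * b / (2 * N * (c + b * k))) f)) := by
  set m := c + b * k
  set s := Real.pi * N * k
  set r := Real.pi * b / (2 * N * m)
  set g := conjOpInv s r f with hg
  have hsol : IsSchrodingerSolution N a b c (fun t => conjOp s r (dil (m * t) g)) := by
    intro t
    have h1 : HasDerivAt (fun t => (dil (m * t) g).toLp 2 volume)
        (((m : ℂ) • dil (m * t) (dilGen g)).toLp 2 volume) t :=
      HasDerivAt.scomp t (dil_hasDerivAt g (m * t))
        (((hasDerivAt_id t).const_mul m).congr_deriv (mul_one m))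
    have h2 := hasDerivAt_iso (norm_conjOp_toLp s r) h1
    have h3 := ham_conjOp hN hk hm (dil (m * t) g)
    refine h2.congr_deriv ?_
    rw [dil_gen_comm, ← h3]
    rfl
  have := propagator_eq hsol
  simpa [dil_zero, hg, conjOp_conjOpInv] using this

/-- The factorization of the propagator into `conjOp`, a dilation and the inverse of `conjOp`
mirrors the diagonalization of the generator: the columns of `P` are its eigenvectors for `-m` and
`m`. -/
theorem intertwines_propagator {N : ℕ} (hN : 1 ≤ N) {a b c : ℝ} (hyp : a * b < c ^ 2) :
    Intertwines N (propagator N a b c)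
      (NormedSpace.exp (!![c, b; -a, -c] : Matrix (Fin 2) (Fin 2) ℝ)) := by
  obtain ⟨k, hk, hm⟩ := exists_slope hyp
  have hN0 : N ≠ 0 := by omega
  have hN' : (N : ℝ) ≠ 0 := by exact_mod_cast hN0
  set m := c + b * k with hmdef
  set s := Real.pi * N * k with hs
  set r := Real.pi * b / (2 * N * m) with hr
  have hprop : propagator N a b c = conjOp s r ∘ dil m ∘ conjOpInv s r :=
    funext fun f => propagator_eq_conj hN hk hm f
  set P : Matrix (Fin 2) (Fin 2) ℝ := !![1, 0; s / (Real.pi * N), 1] *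
      (!![0, -(N : ℝ); 1 / N, 0] * !![1, 0; r / (Real.pi * N), 1]) with hP
  have hPe : P = !![-(b / (2 * N * m)), -N; 1 / N - k * b / (2 * N * m), -(k * N)] := by
    rw [hP, hs, hr]
    ext i j
    fin_cases i <;> fin_cases j <;> simp [Matrix.mul_apply, Fin.sum_univ_two] <;> field_simp <;>
      first | ring1 | (ring_nf; simp)
  have hdet : P.det = 1 := by
    rw [hPe, Matrix.det_fin_two_of]
    field_simp
    ring
  have hu : IsUnit P := (Matrix.isUnit_iff_isUnit_det P).2 (by simp [hdet])
  have hPP : P * P⁻¹ = 1 := Matrix.mul_nonsing_inv P (by simp [hdet])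
  have hXP : (!![c, b; -a, -c] : Matrix (Fin 2) (Fin 2) ℝ) = P * Matrix.diagonal ![-m, m] * P⁻¹ := by
    have : (!![c, b; -a, -c] : Matrix (Fin 2) (Fin 2) ℝ) * P = P * Matrix.diagonal ![-m, m] := by
      have ha : a = -(b * k ^ 2 + 2 * c * k) := by linarith
      rw [hPe, ha]
      ext i j
      fin_cases i <;> fin_cases j <;> simp [Matrix.mul_apply, Fin.sum_univ_two] <;> field_simp <;>
        rw [hmdef] <;> ring
    rw [← this, mul_assoc, hPP, mul_one]
  have hexp : NormedSpace.exp (!![c, b; -a, -c] : Matrix (Fin 2) (Fin 2) ℝ) =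
      P * (Matrix.diagonal ![Real.exp (-m), Real.exp m] * P⁻¹) := by
    rw [hXP, Matrix.exp_conj _ _ hu, Matrix.exp_diagonal, mul_assoc]
    congr 3
    ext i
    fin_cases i <;> simp [Real.exp_eq_exp_ℝ, NormedSpace.exp]
  rw [hexp, hprop]
  have hV : Intertwines N (conjOp s r) P := intertwines_conjOp hN0 s r
  exact hV.comp ((intertwines_dil m).comp
    (hV.inverse (conjOpInv_conjOp s r) (conjOp_conjOpInv s r) hPP))

theorem intertwines_quantization {N : ℕ} (hN : 1 ≤ N)
    {M : Matrix.SpecialLinearGroup (Fin 2) ℤ} {ε : ℤˣ} {a b c : ℝ} (hgen : IsGenerator M ε a b c) :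
    Intertwines N (quantization N ε a b c)
      ((M : Matrix (Fin 2) (Fin 2) ℤ).map (Int.cast : ℤ → ℝ)) := by
  have h := intertwines_propagator hN hgen.hyperbolic
  rw [hgen.eq_exp]
  rcases Int.units_eq_one_or ε with rfl | rfl
  · intro v f
    simpa [quantization] using h v f
  · intro v f
    have := (intertwines_reflection.comp h) v f
    have hne : (-1 : ℤˣ) ≠ 1 := by decide
    simpa [quantization, hne] using this

theorem quantization_surjective {N : ℕ} (hN : 1 ≤ N) {ε : ℤˣ} {a b c : ℝ} (hyp : a * b < c ^ 2) :
    Function.Surjective (quantization N ε a b c) := by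
  obtain ⟨k, hk, hm⟩ := exists_slope hyp
  have hp : Function.Surjective (propagator N a b c) := by
    intro g
    refine ⟨conjOp (Real.pi * N * k) (Real.pi * b / (2 * N * (c + b * k))) (dil (-(c + b * k))
      (conjOpInv (Real.pi * N * k) (Real.pi * b / (2 * N * (c + b * k))) g)), ?_⟩
    rw [propagator_eq_conj hN hk hm, conjOpInv_conjOp, dil_add, add_neg_cancel, dil_zero,
      conjOp_conjOpInv]
  intro g
  by_cases hε : ε = 1
  · obtain ⟨f, hf⟩ := hp g
    exact ⟨f, by simp [quantization, hε, hf]⟩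
  · obtain ⟨f, hf⟩ := hp
      (SchwartzMap.compCLMOfContinuousLinearEquiv ℂ (ContinuousLinearEquiv.neg ℝ) g)
    refine ⟨f, ?_⟩
    ext q
    simp [quantization, hε, hf]

/-! ### Torus states -/

theorem torusStates_shift {N : ℕ} {κ : ℝ × ℝ} {Ψ : ℤ → ℂ} (hΨ : Ψ ∈ torusStates N κ) (k z : ℤ) :
    Ψ (k + z * N) = Complex.exp (-(2 * Real.pi * Complex.I * κ.2)) ^ z * Ψ k := by
  have hstep : ∀ k, Ψ (k + N) = Complex.exp (-(2 * Real.pi * Complex.I * κ.2)) * Ψ k := hΨ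
  have hne := Complex.exp_ne_zero (-(2 * Real.pi * Complex.I * κ.2))
  set e := Complex.exp (-(2 * Real.pi * Complex.I * κ.2))
  induction z using Int.induction_on with
  | zero => simp
  | succ n ih =>
    rw [add_mul, one_mul, ← add_assoc, hstep, ih, zpow_add₀ hne, zpow_one]
    ring
  | pred n ih =>
    have h := hstep (k + (-(n : ℤ) - 1) * N)
    rw [show k + (-(n : ℤ) - 1) * N + N = k + -(n : ℤ) * N by ring, ih] at h
    rw [zpow_sub₀ hne, zpow_one, div_mul_eq_mul_div, h, mul_div_cancel_left₀ _ hne]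

theorem norm_torusStates_shift {N : ℕ} {κ : ℝ × ℝ} {Ψ : ℤ → ℂ} (hΨ : Ψ ∈ torusStates N κ)
    (k z : ℤ) : ‖Ψ (k + z * N)‖ = ‖Ψ k‖ := by
  rw [torusStates_shift hΨ, norm_mul, norm_zpow, Complex.norm_exp]
  simp

theorem exists_representative {N : ℕ} (hN : 1 ≤ N) (k : ℤ) :
    ∃ l ∈ Finset.Icc 1 N, ∃ z : ℤ, k = (l : ℤ) + z * N := by
  have hN' : (0 : ℤ) < N := by exact_mod_cast hN
  have h0 := Int.emod_nonneg (k - 1) hN'.ne'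
  have h1 := Int.emod_lt_of_pos (k - 1) hN'
  have h2 := Int.emod_add_mul_ediv (k - 1) N
  refine ⟨((k - 1) % N).toNat + 1, by simp; omega, (k - 1) / N, ?_⟩
  push_cast
  rw [Int.toNat_of_nonneg h0]
  linarith

theorem torusStates_ext {N : ℕ} (hN : 1 ≤ N) {κ : ℝ × ℝ} {Ψ Φ : ℤ → ℂ} (hΨ : Ψ ∈ torusStates N κ)
    (hΦ : Φ ∈ torusStates N κ) (h : ∀ l ∈ Finset.Icc 1 N, Ψ (l : ℤ) = Φ (l : ℤ)) : Ψ = Φ := by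
  funext k
  obtain ⟨l, hl, z, rfl⟩ := exists_representative hN k
  rw [torusStates_shift hΨ, torusStates_shift hΦ, h l hl]

theorem torusStates_bounded {N : ℕ} (hN : 1 ≤ N) {κ : ℝ × ℝ} {Ψ : ℤ → ℂ}
    (hΨ : Ψ ∈ torusStates N κ) : ∃ C, ∀ k, ‖Ψ k‖ ≤ C := by
  refine ⟨∑ l ∈ Finset.Icc 1 N, ‖Ψ (l : ℤ)‖, fun k => ?_⟩
  obtain ⟨l, hl, z, rfl⟩ := exists_representative hN k
  rw [norm_torusStates_shift hΨ]
  exact Finset.single_le_sum (f := fun l : ℕ => ‖Ψ (l : ℤ)‖) (fun _ _ => norm_nonneg _) hl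

theorem summable_inv_one_add_int_sq : Summable fun k : ℤ => (1 + (k : ℝ) ^ 2)⁻¹ := by
  have h : Summable fun k : ℤ => 1 / (k : ℝ) ^ 2 := Real.summable_one_div_int_pow.2 (by norm_num)
  refine h.of_norm_bounded_eventually ?_
  have hfin : ({0} : Set ℤ).Finite := Set.finite_singleton 0
  filter_upwards [hfin.compl_mem_cofinite] with k hk
  have hk' : (0 : ℝ) < (k : ℝ) ^ 2 := by
    have : (k : ℝ) ≠ 0 := by simpa using hk
    positivity
  rw [Real.norm_of_nonneg (by positivity), one_div]
  exact inv_anti₀ hk' (by linarith)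

theorem summable_pairing {N : ℕ} (hN : 1 ≤ N) {κ : ℝ × ℝ} {Ψ : ℤ → ℂ} (hΨ : Ψ ∈ torusStates N κ)
    (f : 𝓢(ℝ, ℂ)) : Summable fun k : ℤ => Ψ k * conj (f ((k + κ.1) / N)) := by
  obtain ⟨B, hB⟩ := torusStates_bounded hN hΨ
  obtain ⟨C, hC, hf⟩ := decay_bound f
  have hN1 : (1 : ℝ) ≤ N := by exact_mod_cast hN
  have hB0 : 0 ≤ B := (norm_nonneg _).trans (hB 0)
  -- With `x = (k + κ₁) / N`, so `k = N x - κ₁`, one has `k² ≤ 2 N² x² + 2 κ₁²`. This converts decay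
  -- in `x` into decay in `k` and produces the constant.
  refine (summable_inv_one_add_int_sq.mul_left
    (B * (C * (2 * N ^ 2 + 2 * κ.1 ^ 2 + 1)))).of_norm_bounded fun k => ?_
  rw [norm_mul, RCLike.norm_conj, mul_assoc]
  refine mul_le_mul (hB k) ((hf _).trans ?_) (norm_nonneg _) hB0
  rw [mul_assoc, div_eq_mul_inv]
  refine mul_le_mul_of_nonneg_left ?_ hC.le
  rw [← div_eq_mul_inv, inv_eq_one_div, div_le_div_iff₀ (by positivity) (by positivity)]
  obtain ⟨x, hx⟩ : ∃ x : ℝ, x = (k + κ.1) / N := ⟨_, rfl⟩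
  have hk : (k : ℝ) = N * x - κ.1 := by rw [hx]; field_simp; ring
  rw [← hx, hk]
  nlinarith [sq_nonneg (N * x + κ.1), mul_nonneg (sq_nonneg κ.1) (sq_nonneg x), sq_nonneg x]

theorem pairing_sum {N : ℕ} (hN : 1 ≤ N) {κ : ℝ × ℝ} {ι : Type*} (s : Finset ι) (c : ι → ℂ)
    {φ : ι → ℤ → ℂ} (hφ : ∀ j, φ j ∈ torusStates N κ) (f : 𝓢(ℝ, ℂ)) :
    pairing N κ (∑ j ∈ s, c j • φ j) f = ∑ j ∈ s, c j * pairing N κ (φ j) f := by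
  simp only [pairing, Finset.sum_apply, Pi.smul_apply, smul_eq_mul, Finset.sum_mul, mul_assoc]
  rw [Summable.tsum_finsetSum fun j _ => (summable_pairing hN (hφ j) f).mul_left _]
  simp only [tsum_mul_left]

/-- The atoms are `1 / N` apart, so a bump function supported within `1 / N` of one of them reads
off a single coefficient. -/
theorem eq_of_pairing_eq {N : ℕ} (hN : 1 ≤ N) {κ : ℝ × ℝ} {Ψ Φ : ℤ → ℂ}
    (h : ∀ f, pairing N κ Ψ f = pairing N κ Φ f) : Ψ = Φ := by
  funext k
  have hN0 : (0 : ℝ) < N := by exact_mod_cast hN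
  obtain ⟨g, hg, hgc, hgs, -, hg1⟩ := exists_contDiff_tsupport_subset (n := ⊤)
    (Metric.ball_mem_nhds ((k + κ.1) / N : ℝ) (by positivity : (0 : ℝ) < 1 / N))
  have hc : HasCompactSupport fun x => (g x : ℂ) := hgc.comp_left Complex.ofReal_zero
  have hs : ContDiff ℝ ((⊤ : ℕ∞) : WithTop ℕ∞) fun x => (g x : ℂ) := Complex.ofRealCLM.contDiff.comp hgs
  have key : ∀ X : ℤ → ℂ, pairing N κ X (hc.toSchwartzMap hs) = X k := by
    intro X
    rw [pairing, tsum_eq_single k]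
    · simp [hg1]
    · intro l hl
      have : g ((l + κ.1) / N) = 0 := by
        by_contra hne
        have := hg (subset_tsupport _ (Function.mem_support.2 hne))
        rw [Metric.mem_ball, Real.dist_eq, ← sub_div, abs_div, abs_of_pos hN0,
          div_lt_div_iff_of_pos_right hN0, add_sub_add_right_eq_sub] at this
        have h2 : |l - k| < 1 := by exact_mod_cast this
        rw [Int.abs_lt_one_iff] at h2
        omega
      simp [this]
  rw [← key Ψ, ← key Φ, h]

/-! ### Weyl operators on torus states -/

/-- The adjoint action of the Weyl operator of `w / N` on states. -/
def shiftOp (N : ℕ) (κ : ℝ × ℝ) (w : Fin 2 → ℤ) (Ψ : ℤ → ℂ) : ℤ → ℂ := fun k =>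
  Complex.exp (-(2 * Real.pi * Complex.I * w 1 * (k + κ.1) / N
    + Real.pi * Complex.I * w 0 * w 1 / N)) * Ψ (k + w 0)

theorem shiftOp_mem {N : ℕ} (hN : 1 ≤ N) {κ : ℝ × ℝ} (w : Fin 2 → ℤ) {Ψ : ℤ → ℂ}
    (hΨ : Ψ ∈ torusStates N κ) : shiftOp N κ w Ψ ∈ torusStates N κ := by
  intro k
  have h : ∀ k, Ψ (k + N) = Complex.exp (-(2 * Real.pi * Complex.I * κ.2)) * Ψ k := hΨ
  have hN' : (N : ℂ) ≠ 0 := by exact_mod_cast (by omega : N ≠ 0)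
  simp only [shiftOp]
  rw [show k + N + w 0 = k + w 0 + N by ring, h, mul_left_comm]
  congr 2
  rw [Complex.exp_eq_exp_iff_exists_int]
  -- Moving `k` by `N` multiplies the phase by `exp (-2πi w₁)`, which is `1` because `w₁` is an
  -- integer.
  refine ⟨-w 1, ?_⟩
  push_cast
  field_simp
  ring

theorem pairing_weyl {N : ℕ} (hN : 1 ≤ N) (κ : ℝ × ℝ) (w : Fin 2 → ℤ) (Ψ : ℤ → ℂ) (f : 𝓢(ℝ, ℂ)) :
    pairing N κ Ψ (weyl N (fun i => w i / N) f) = pairing N κ (shiftOp N κ w Ψ) f := by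
  have hN' : (N : ℝ) ≠ 0 := by exact_mod_cast (by omega : N ≠ 0)
  have hN'' : (N : ℂ) ≠ 0 := by exact_mod_cast (by omega : N ≠ 0)
  rw [pairing, ← (Equiv.addRight (w 0)).tsum_eq, pairing]
  congr 1
  ext k
  simp only [Equiv.coe_addRight, weyl_apply, shiftOp, map_mul, ← Complex.exp_conj, Complex.conj_I,
    Complex.conj_ofReal]
  rw [show ((k + w 0 : ℤ) + κ.1) / N - w 0 / N = (k + κ.1) / N by push_cast; field_simp; ring,
    mul_left_comm, ← mul_assoc]
  congr 2
  push_cast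
  field_simp
  ring_nf

/-- Exact Egorov on the torus, obtained by duality from `intertwines_quantization`. Integrality of
`M` keeps the shift vector in `ℤ²`. -/
theorem isImage_shiftOp {N : ℕ} (hN : 1 ≤ N) {M : Matrix.SpecialLinearGroup (Fin 2) ℤ} {ε : ℤˣ}
    {a b c : ℝ} (hgen : IsGenerator M ε a b c) {κ : ℝ × ℝ} {Ψ Φ : ℤ → ℂ}
    (h : IsImage N ε a b c κ Ψ Φ) (w : Fin 2 → ℤ) :
    IsImage N ε a b c κ (shiftOp N κ w Ψ)
      (shiftOp N κ ((M : Matrix (Fin 2) (Fin 2) ℤ).mulVec w) Φ) := by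
  intro f
  have hv : ((M : Matrix (Fin 2) (Fin 2) ℤ).map (Int.cast : ℤ → ℝ)).mulVec
      (fun i => (w i / N : ℝ)) =
      fun i => (((M : Matrix (Fin 2) (Fin 2) ℤ).mulVec w i : ℤ) : ℝ) / N := by
    ext i
    simp only [Matrix.mulVec, dotProduct, Matrix.map_apply]
    push_cast
    rw [Finset.sum_div]
    simp only [mul_div_assoc]
  rw [← pairing_weyl hN, ← pairing_weyl hN, ← h, intertwines_quantization hN hgen, hv]

/-! ### Orthonormal bases of states -/

theorem stateInner_sum (N : ℕ) {ι : Type*} (s : Finset ι) (c : ι → ℂ) (φ : ι → ℤ → ℂ) (Φ : ℤ → ℂ) :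
    stateInner N (∑ j ∈ s, c j • φ j) Φ = ∑ j ∈ s, c j * stateInner N (φ j) Φ := by
  simp only [stateInner, Finset.sum_apply, Pi.smul_apply, smul_eq_mul, Finset.mul_sum, Finset.sum_mul]
  rw [Finset.sum_comm]
  refine Finset.sum_congr rfl fun j _ => Finset.sum_congr rfl fun k _ => ?_
  ring

theorem sum_Icc_eq_sum_fin {E : Type*} [AddCommMonoid E] (N : ℕ) (f : ℕ → E) :
    ∑ k ∈ Finset.Icc 1 N, f k = ∑ i : Fin N, f (i + 1) := by
  rw [← Fin.sum_univ_eq_sum_range (fun i => f (i + 1)) N |>.symm, Finset.range_eq_Ico,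
    Finset.sum_Ico_add' f 0 N 1, zero_add]
  rfl

section Basis

variable {N : ℕ} {κ : ℝ × ℝ} {φ : Fin N → ℤ → ℂ}

/-- Orthonormality of the `N` states says that a square matrix has a one-sided inverse. The inverse
is then two-sided, which gives orthogonality of the columns. -/
theorem sum_mul_conj_eq (hN : 1 ≤ N)
    (hon : ∀ i j, stateInner N (φ i) (φ j) = if i = j then 1 else 0) {k l : ℕ}
    (hk : k ∈ Finset.Icc 1 N) (hl : l ∈ Finset.Icc 1 N) :
    ∑ j, φ j (k : ℤ) * conj (φ j (l : ℤ)) = if k = l then (N : ℂ) else 0 := by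
  have hN' : (N : ℂ) ≠ 0 := by exact_mod_cast (by omega : N ≠ 0)
  let U : Matrix (Fin N) (Fin N) ℂ := fun j i => (N : ℂ)⁻¹ * φ j ((i + 1 : ℕ) : ℤ)
  let V : Matrix (Fin N) (Fin N) ℂ := fun i j => conj (φ j ((i + 1 : ℕ) : ℤ))
  have hUV : U * V = 1 := by
    ext i j
    have := hon i j
    rw [stateInner, sum_Icc_eq_sum_fin N (fun k : ℕ => φ i (k : ℤ) * conj (φ j (k : ℤ))),
      Finset.mul_sum] at this
    rw [Matrix.mul_apply, Matrix.one_apply, ← this]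
    refine Finset.sum_congr rfl fun k _ => ?_
    simp only [U, V]
    ring
  have hVU := mul_eq_one_comm.1 hUV
  rw [Finset.mem_Icc] at hk hl
  have h := congrFun (congrFun hVU ⟨l - 1, by omega⟩) ⟨k - 1, by omega⟩
  rw [Matrix.mul_apply] at h
  simp only [U, V, Matrix.one_apply, Nat.sub_add_cancel hk.1,
    Nat.sub_add_cancel hl.1, Fin.mk.injEq] at h
  have hiff : (l - 1 = k - 1) ↔ k = l := by omega
  simp only [hiff] at h
  have h2 : ∑ j, φ j (k : ℤ) * conj (φ j (l : ℤ)) =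
      N * ∑ j, conj (φ j (l : ℤ)) * ((N : ℂ)⁻¹ * φ j (k : ℤ)) := by
    rw [Finset.mul_sum]
    refine Finset.sum_congr rfl fun j _ => ?_
    field_simp
  rw [h2, h]
  split_ifs <;> simp

theorem sum_mul_conj_eq_zero (hN : 1 ≤ N) (hmem : ∀ j, φ j ∈ torusStates N κ)
    (hon : ∀ i j, stateInner N (φ i) (φ j) = if i = j then 1 else 0) {k l : ℤ}
    (hkl : ¬ (N : ℤ) ∣ k - l) : ∑ j, φ j k * conj (φ j l) = 0 := by
  obtain ⟨k', hk', y, rfl⟩ := exists_representative hN k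
  obtain ⟨l', hl', z, rfl⟩ := exists_representative hN l
  have hne : k' ≠ l' := by
    rintro rfl
    exact hkl ⟨y - z, by ring⟩
  simp only [torusStates_shift (hmem _), map_mul, mul_mul_mul_comm _ (φ _ _)]
  rw [← Finset.mul_sum, sum_mul_conj_eq hN hon hk' hl', if_neg hne, mul_zero]

theorem sum_norm_sq_eq (hN : 1 ≤ N) (hmem : ∀ j, φ j ∈ torusStates N κ)
    (hon : ∀ i j, stateInner N (φ i) (φ j) = if i = j then 1 else 0) (k : ℤ) :
    ∑ j, ‖φ j k‖ ^ 2 = N := by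
  obtain ⟨l, hl, z, rfl⟩ := exists_representative hN k
  simp only [norm_torusStates_shift (hmem _)]
  have := sum_mul_conj_eq hN hon hl hl
  simp only [Complex.mul_conj', if_true] at this
  exact_mod_cast this

theorem eq_sum_stateInner (hN : 1 ≤ N) (hmem : ∀ j, φ j ∈ torusStates N κ)
    (hon : ∀ i j, stateInner N (φ i) (φ j) = if i = j then 1 else 0) {Ψ : ℤ → ℂ}
    (hΨ : Ψ ∈ torusStates N κ) : Ψ = ∑ j, stateInner N Ψ (φ j) • φ j := by
  refine torusStates_ext hN hΨ
    (Submodule.sum_mem _ fun j _ => Submodule.smul_mem _ _ (hmem j)) fun k hk => ?_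
  have hN' : (N : ℂ) ≠ 0 := by exact_mod_cast (by omega : N ≠ 0)
  simp only [Finset.sum_apply, Pi.smul_apply, smul_eq_mul, stateInner, mul_assoc]
  rw [← Finset.mul_sum]
  simp only [Finset.sum_mul]
  rw [Finset.sum_comm]
  have : ∀ l ∈ Finset.Icc 1 N, ∑ j, Ψ (l : ℤ) * conj (φ j (l : ℤ)) * φ j (k : ℤ) =
      if k = l then Ψ (l : ℤ) * N else 0 := by
    intro l hl
    rw [← mul_ite_zero, ← sum_mul_conj_eq hN hon hk hl, Finset.mul_sum]
    refine Finset.sum_congr rfl fun j _ => ?_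
    ring
  rw [Finset.sum_congr rfl this, Finset.sum_ite_eq, if_pos hk]
  field_simp

/-- Expand the shifted eigenstate in the eigenbasis and apply the cat map. Egorov evaluates the
image as `λᵢ` times the state shifted by `M w`, while linearity multiplies the `j`-th coefficient by
`λⱼ`. In the `i`-th coefficient the factor `λᵢ` cancels. -/
theorem stateInner_shiftOp_mulVec (hN : 1 ≤ N) {M : Matrix.SpecialLinearGroup (Fin 2) ℤ} {ε : ℤˣ}
    {a b c : ℝ} (hgen : IsGenerator M ε a b c) (hφ : IsEigenbasis N ε a b c κ φ)
    (w : Fin 2 → ℤ) (i : Fin N) :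
    stateInner N (shiftOp N κ ((M : Matrix (Fin 2) (Fin 2) ℤ).mulVec w) (φ i)) (φ i) =
      stateInner N (shiftOp N κ w (φ i)) (φ i) := by
  choose θ hθ using hφ.eigen
  set lam : Fin N → ℂ := fun j => Complex.exp (Complex.I * θ j) with hlam
  have hexp := eq_sum_stateInner hN hφ.mem hφ.orthonormal (shiftOp_mem hN w (hφ.mem i))
  set d : Fin N → ℂ := fun j => stateInner N (shiftOp N κ w (φ i)) (φ j) with hd
  have hlin : ∀ (z : ℂ) (v : Fin 2 → ℤ) (Ψ : ℤ → ℂ),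
      shiftOp N κ v (z • Ψ) = z • shiftOp N κ v Ψ := by
    intro z v Ψ
    ext k
    simp only [shiftOp, Pi.smul_apply, smul_eq_mul]
    ring
  have heq : lam i • shiftOp N κ ((M : Matrix (Fin 2) (Fin 2) ℤ).mulVec w) (φ i) =
      ∑ j, (d j * lam j) • φ j := by
    refine eq_of_pairing_eq (κ := κ) hN fun g => ?_
    -- `IsImage` only tests against functions in the range of the quantization. Surjectivity makes
    -- these all Schwartz functions.
    obtain ⟨f, rfl⟩ := quantization_surjective (ε := ε) hN hgen.hyperbolic g
    have h1 := isImage_shiftOp hN hgen (hθ i) w f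
    rw [hlin] at h1
    rw [h1, hexp, pairing_sum hN _ _ hφ.mem, pairing_sum hN _ _ hφ.mem]
    refine Finset.sum_congr rfl fun j _ => ?_
    have h2 := hθ j f
    have h3 := pairing_sum hN {j} (fun _ => lam j) hφ.mem (quantization N ε a b c f)
    simp only [Finset.sum_singleton] at h3
    rw [← h2, h3]
    ring
  have h := congrArg (fun X => stateInner N X (φ i)) heq
  simp only [stateInner_sum, hφ.orthonormal, mul_ite, mul_one, mul_zero, Finset.sum_ite_eq',
    Finset.mem_univ, if_true] at h
  have h4 := stateInner_sum N {i} (fun _ => lam i)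
    (fun _ => shiftOp N κ ((M : Matrix (Fin 2) (Fin 2) ℤ).mulVec w) (φ i)) (φ i)
  simp only [Finset.sum_singleton] at h4
  rw [h4, mul_comm] at h
  exact mul_right_cancel₀ (Complex.exp_ne_zero _) h

end Basis

/-! ### The quantum variance -/

section Recurrence

variable {a : ℕ → ℤ} {τ : ℤ}

/-- If `|a t| < |a (t + 1)|`, then `|a (t + 2)| ≥ 3 |a (t + 1)| - |a t| > |a (t + 1)|`. -/
theorem abs_strictMono_of_recurrence (hτ : 3 ≤ |τ|) (h0 : a 0 = 0) (h1 : a 1 ≠ 0)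
    (hrec : ∀ t, a (t + 2) = τ * a (t + 1) - a t) : StrictMono fun t => |a t| := by
  refine strictMono_nat_of_lt_succ fun t => ?_
  induction t with
  | zero => simpa [h0] using h1
  | succ t ih =>
    have h := abs_sub_abs_le_abs_sub (τ * a (t + 1)) (a t)
    rw [abs_mul] at h
    simp only [hrec]
    nlinarith [abs_nonneg (a t), abs_nonneg (a (t + 1))]

theorem abs_le_of_recurrence (hτ : 3 ≤ |τ|) (h0 : a 0 = 0) (h1 : a 1 ≠ 0)
    (hrec : ∀ t, a (t + 2) = τ * a (t + 1) - a t) (t : ℕ) : |a t| ≤ (|τ| + 1) ^ t * |a 1| := by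
  have hmono := abs_strictMono_of_recurrence hτ h0 h1 hrec
  induction t with
  | zero => simp [h0]
  | succ t ih =>
    -- The one-step bound fails at `t = 0`, where `a 0 = 0` but `a 1 ≠ 0`.
    have hstep : |a (t + 1)| ≤ (|τ| + 1) * |a t| ∨ t = 0 := by
      rcases t with _ | t
      · exact Or.inr rfl
      · left
        have h := abs_sub (τ * a (t + 1)) (a t)
        rw [abs_mul] at h
        have h2 : |a t| < |a (t + 1)| := hmono (Nat.lt_succ_self t)
        rw [hrec]
        linarith
    rcases hstep with h | rfl
    · rw [pow_succ']
      calc |a (t + 1)| ≤ (|τ| + 1) * |a t| := h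
        _ ≤ (|τ| + 1) * ((|τ| + 1) ^ t * |a 1|) := by gcongr
        _ = _ := by ring
    · have := abs_nonneg (a 1)
      simp only [zero_add, pow_one]
      nlinarith

end Recurrence

/-- A triangular integer matrix of determinant one has diagonal `(1, 1)` or `(-1, -1)`, hence trace
`± 2`. -/
theorem offDiag_ne_zero {M : Matrix.SpecialLinearGroup (Fin 2) ℤ}
    (hM : 2 < |Matrix.trace (M : Matrix (Fin 2) (Fin 2) ℤ)|) :
    (M : Matrix (Fin 2) (Fin 2) ℤ) 0 1 ≠ 0 := by
  intro h
  have hdet := M.det_coe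
  rw [Matrix.det_fin_two, h, zero_mul, sub_zero] at hdet
  rw [Matrix.trace_fin_two] at hM
  rcases Int.mul_eq_one_iff_eq_one_or_neg_one.1 hdet with ⟨h1, h2⟩ | ⟨h1, h2⟩ <;>
    rw [h1, h2] at hM <;> simp at hM

/-- The first coordinates of the orbit of `(0, n)` under `M`. -/
def orbitCoord (M : Matrix (Fin 2) (Fin 2) ℤ) (n : ℤ) (t : ℕ) : ℤ := (M ^ t).mulVec ![0, n] 0

theorem orbitCoord_zero (M : Matrix (Fin 2) (Fin 2) ℤ) (n : ℤ) : orbitCoord M n 0 = 0 := by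
  simp [orbitCoord]

theorem orbitCoord_one (M : Matrix (Fin 2) (Fin 2) ℤ) (n : ℤ) : orbitCoord M n 1 = M 0 1 * n := by
  simp [orbitCoord, Matrix.mulVec, dotProduct, Fin.sum_univ_two]

theorem orbitCoord_add_two {M : Matrix (Fin 2) (Fin 2) ℤ} (hM : M.det = 1) (n : ℤ) (t : ℕ) :
    orbitCoord M n (t + 2) = M.trace * orbitCoord M n (t + 1) - orbitCoord M n t := by
  -- The Cayley–Hamilton identity for determinant one.
  have h : M ^ 2 = M.trace • M - 1 := by
    rw [Matrix.det_fin_two] at hM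
    ext i j
    fin_cases i <;> fin_cases j <;>
      simp [pow_two, Matrix.mul_apply, Fin.sum_univ_two, Matrix.trace_fin_two, Matrix.smul_apply,
        -zsmul_eq_mul] <;> linarith
  have h' : M ^ (t + 2) = M.trace • M ^ (t + 1) - M ^ t := by
    rw [pow_add, h, mul_sub, mul_one, mul_smul_comm, pow_succ]
  simp only [orbitCoord, h', Matrix.sub_mulVec, Matrix.smul_mulVec, Pi.sub_apply, Pi.smul_apply,
    smul_eq_mul]

/-- Up to time `T` the coordinates are too small to be congruent modulo `N` without being equal, and
strict growth excludes equality. -/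
theorem orbitCoord_not_dvd {M : Matrix.SpecialLinearGroup (Fin 2) ℤ}
    (hM : 2 < |Matrix.trace (M : Matrix (Fin 2) (Fin 2) ℤ)|) {N n T : ℕ} (hn : 1 ≤ n)
    (hN : 2 * |(M : Matrix (Fin 2) (Fin 2) ℤ) 0 1| * n *
      (|Matrix.trace (M : Matrix (Fin 2) (Fin 2) ℤ)| + 1) ^ T < N)
    {s t : ℕ} (hs : s ≤ T) (ht : t ≤ T) (hst : s ≠ t) :
    ¬ (N : ℤ) ∣ orbitCoord M n s - orbitCoord M n t := by
  set τ := Matrix.trace (M : Matrix (Fin 2) (Fin 2) ℤ)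
  set a := orbitCoord (M : Matrix (Fin 2) (Fin 2) ℤ) n
  have hτ : 3 ≤ |τ| := by omega
  have h0 : a 0 = 0 := orbitCoord_zero _ _
  have h1e : a 1 = (M : Matrix (Fin 2) (Fin 2) ℤ) 0 1 * n := orbitCoord_one _ _
  have h1 : a 1 ≠ 0 := by
    rw [h1e]
    exact mul_ne_zero (offDiag_ne_zero hM) (by omega)
  have hrec : ∀ t, a (t + 2) = τ * a (t + 1) - a t := orbitCoord_add_two M.det_coe _
  have hmono := abs_strictMono_of_recurrence hτ h0 h1 hrec
  have hle : ∀ t ≤ T, |a t| ≤ (|τ| + 1) ^ T * |a 1| := fun t ht =>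
    (abs_le_of_recurrence hτ h0 h1 hrec t).trans (by gcongr; omega)
  rw [h1e, abs_mul, Nat.abs_cast] at hle
  intro hdvd
  have hlt : |a s - a t| < N := by
    have := abs_sub (a s) (a t)
    have := hle s hs
    have := hle t ht
    linarith
  have := Int.eq_zero_of_abs_lt_dvd hdvd hlt
  exact hst (hmono.injective (by simp only [sub_eq_zero.1 this]))

theorem norm_sq_stateInner_le {N : ℕ} (hN : 1 ≤ N) (Ψ : ℤ → ℂ) {Φ : ℤ → ℂ}
    (hΦ : stateInner N Φ Φ = 1) :
    ‖stateInner N Ψ Φ‖ ^ 2 ≤ (1 / N : ℝ) * ∑ k ∈ Finset.Icc 1 N, ‖Ψ (k : ℤ)‖ ^ 2 := by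
  have hN' : (0 : ℝ) < N := by exact_mod_cast hN
  have hΦ' : ∑ k ∈ Finset.Icc 1 N, ‖Φ (k : ℤ)‖ ^ 2 = N := by
    have hN'' : (N : ℂ) ≠ 0 := by exact_mod_cast hN'.ne'
    simp only [stateInner, Complex.mul_conj'] at hΦ
    field_simp at hΦ
    exact_mod_cast hΦ
  have h1 : ‖stateInner N Ψ Φ‖ ≤ (1 / N : ℝ) * ∑ k ∈ Finset.Icc 1 N, ‖Ψ (k : ℤ)‖ * ‖Φ (k : ℤ)‖ := by
    rw [stateInner, norm_mul]
    simp only [norm_div, norm_one, Complex.norm_natCast]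
    gcongr
    refine (norm_sum_le _ _).trans_eq ?_
    simp only [norm_mul, RCLike.norm_conj]
  have h2 := Finset.sum_mul_sq_le_sq_mul_sq (Finset.Icc 1 N) (fun k : ℕ => ‖Ψ (k : ℤ)‖)
    (fun k : ℕ => ‖Φ (k : ℤ)‖)
  rw [hΦ'] at h2
  calc ‖stateInner N Ψ Φ‖ ^ 2
      ≤ ((1 / N : ℝ) * ∑ k ∈ Finset.Icc 1 N, ‖Ψ (k : ℤ)‖ * ‖Φ (k : ℤ)‖) ^ 2 := by gcongr
    _ ≤ (1 / N : ℝ) ^ 2 * ((∑ k ∈ Finset.Icc 1 N, ‖Ψ (k : ℤ)‖ ^ 2) * N) := by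
      rw [mul_pow]
      gcongr
    _ = _ := by field_simp

theorem norm_shiftOp_factor (N : ℕ) (x : ℝ) (w : Fin 2 → ℤ) (k : ℤ) :
    ‖Complex.exp (-(2 * Real.pi * Complex.I * w 1 * (k + x) / N
      + Real.pi * Complex.I * w 0 * w 1 / N))‖ = 1 := by
  have : -(2 * Real.pi * Complex.I * w 1 * (k + x) / N + Real.pi * Complex.I * w 0 * w 1 / N) =
      ((-(2 * Real.pi * w 1 * (k + x) / N + Real.pi * w 0 * w 1 / N) : ℝ) : ℂ) * Complex.I := by
    push_cast
    ring
  rw [this, Complex.norm_exp_ofReal_mul_I]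

/-- The variance of averages of Weyl operators whose shifts are distinct modulo `N`. -/
theorem sum_norm_sq_stateInner_le {N : ℕ} (hN : 1 ≤ N) {κ : ℝ × ℝ} {φ : Fin N → ℤ → ℂ}
    (hmem : ∀ j, φ j ∈ torusStates N κ)
    (hon : ∀ i j, stateInner N (φ i) (φ j) = if i = j then 1 else 0)
    {s : Finset ℕ} (hs : s.Nonempty) (w : ℕ → Fin 2 → ℤ)
    (hw : ∀ t ∈ s, ∀ u ∈ s, t ≠ u → ¬ (N : ℤ) ∣ w t 0 - w u 0) (z : Fin N → ℂ)
    (hz : ∀ i, ∀ t ∈ s, stateInner N (shiftOp N κ (w t) (φ i)) (φ i) = z i) :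
    ∑ i, ‖z i‖ ^ 2 ≤ N / s.card := by
  have hN' : (0 : ℝ) < N := by exact_mod_cast hN
  have hc : (0 : ℝ) < s.card := by exact_mod_cast hs.card_pos
  set Ψ : Fin N → ℤ → ℂ := fun i => ∑ t ∈ s, (1 : ℂ) • shiftOp N κ (w t) (φ i) with hΨ
  have hone : ∀ i, stateInner N (φ i) (φ i) = 1 := fun i => by simp [hon]
  have h1 : ∀ i, stateInner N (Ψ i) (φ i) = s.card * z i := by
    intro i
    rw [hΨ, stateInner_sum]
    simp only [one_mul]
    rw [Finset.sum_congr rfl (hz i), Finset.sum_const, nsmul_eq_mul]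
  -- Hilbert–Schmidt orthogonality, pointwise in `k`: column orthogonality kills the terms `t ≠ u`,
  -- since their shifts differ modulo `N`, and each diagonal term contributes `N`.
  have h2 : ∀ k : ℤ, ∑ i, ‖Ψ i k‖ ^ 2 = s.card * N := by
    intro k
    set θ : ℕ → ℂ := fun t => Complex.exp (-(2 * Real.pi * Complex.I * w t 1 * (k + κ.1) / N
      + Real.pi * Complex.I * w t 0 * w t 1 / N)) with hθ
    have hθ1 : ∀ t, ‖θ t‖ = 1 := fun t => norm_shiftOp_factor _ _ _ _
    have hval : ∀ i, Ψ i k = ∑ t ∈ s, θ t * φ i (k + w t 0) := by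
      intro i
      simp only [hΨ, Finset.sum_apply, one_smul]
      rfl
    have : ∑ i, ((‖Ψ i k‖ ^ 2 : ℝ) : ℂ) = s.card * N := by
      calc ∑ i, ((‖Ψ i k‖ ^ 2 : ℝ) : ℂ)
          = ∑ i, ∑ t ∈ s, ∑ u ∈ s,
            θ t * conj (θ u) * (φ i (k + w t 0) * conj (φ i (k + w u 0))) := by
            refine Finset.sum_congr rfl fun i _ => ?_
            push_cast
            rw [← Complex.mul_conj', hval, map_sum, Finset.sum_mul_sum]
            refine Finset.sum_congr rfl fun t _ => Finset.sum_congr rfl fun u _ => ?_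
            rw [map_mul]
            ring
        _ = ∑ t ∈ s, ∑ u ∈ s,
            θ t * conj (θ u) * ∑ i, φ i (k + w t 0) * conj (φ i (k + w u 0)) := by
            rw [Finset.sum_comm]
            refine Finset.sum_congr rfl fun t _ => ?_
            rw [Finset.sum_comm]
            simp only [Finset.mul_sum]
        _ = ∑ t ∈ s, ∑ u ∈ s, if t = u then (N : ℂ) else 0 := by
            refine Finset.sum_congr rfl fun t ht => Finset.sum_congr rfl fun u hu => ?_
            split_ifs with h
            · subst h
              simp only [Complex.mul_conj', hθ1]
              have := sum_norm_sq_eq hN hmem hon (k + w t 0)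
              have h3 : ∑ i, ((‖φ i (k + w t 0)‖ : ℂ)) ^ 2 = N := by exact_mod_cast this
              rw [h3]
              simp
            · rw [sum_mul_conj_eq_zero hN hmem hon, mul_zero]
              rw [add_sub_add_left_eq_sub]
              exact hw t ht u hu h
        _ = s.card * N := by
            simp +contextual
    exact_mod_cast this
  have h3 : ∀ i, (s.card : ℝ) ^ 2 * ‖z i‖ ^ 2 ≤
      (1 / N : ℝ) * ∑ k ∈ Finset.Icc 1 N, ‖Ψ i (k : ℤ)‖ ^ 2 := by
    intro i
    have := norm_sq_stateInner_le hN (Ψ i) (hone i)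
    rwa [h1, norm_mul, mul_pow, Complex.norm_natCast] at this
  have h4 : (s.card : ℝ) ^ 2 * ∑ i, ‖z i‖ ^ 2 ≤ s.card * N := by
    rw [Finset.mul_sum]
    refine (Finset.sum_le_sum fun i _ => h3 i).trans_eq ?_
    rw [← Finset.mul_sum, Finset.sum_comm]
    simp only [h2]
    simp
    field_simp
  rw [le_div_iff₀ hc]
  nlinarith

/-- The `n`-th Fourier coefficient of the position density of a state. -/
def densityCoeff (N : ℕ) (κ : ℝ × ℝ) (n : ℕ) (Ψ : ℤ → ℂ) : ℂ :=
  stateInner N (shiftOp N κ ![0, n] Ψ) Ψ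

/-- The base `R ^ 4` of the logarithm shares out powers of `N`: `R ^ T ≤ N^(1/4)`, `n ≤ N^(1/2)` and
`2 |M₀₁| < N^(1/4)`. The product is below `N`, as `orbitCoord_not_dvd` requires. -/
theorem sum_norm_sq_densityCoeff_le {M : Matrix.SpecialLinearGroup (Fin 2) ℤ}
    (hM : 2 < |Matrix.trace (M : Matrix (Fin 2) (Fin 2) ℤ)|) {ε : ℤˣ} {a b c : ℝ}
    (hgen : IsGenerator M ε a b c) {N : ℕ}
    (hN : (2 * |(M : Matrix (Fin 2) (Fin 2) ℤ) 0 1|) ^ 4 < N) {κ : ℝ × ℝ} {φ : Fin N → ℤ → ℂ}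
    (hφ : IsEigenbasis N ε a b c κ φ) {n : ℕ} (hn : 1 ≤ n) (hnN : n ^ 2 ≤ N) :
    ∑ i, ‖densityCoeff N κ n (φ i)‖ ^ 2 ≤
      N / ((Nat.log (((Matrix.trace (M : Matrix (Fin 2) (Fin 2) ℤ)).natAbs + 1) ^ 4) N : ℝ) + 1) := by
  set R := (Matrix.trace (M : Matrix (Fin 2) (Fin 2) ℤ)).natAbs + 1 with hR
  set T := Nat.log (R ^ 4) N with hT
  have hN1 : 1 ≤ N := by nlinarith
  have hRT : ((R : ℤ) ^ T) ^ 4 ≤ N := by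
    have := Nat.pow_log_le_self (R ^ 4) (by omega : N ≠ 0)
    rw [← pow_mul, mul_comm, pow_mul]
    exact_mod_cast this
  have hRe : |Matrix.trace (M : Matrix (Fin 2) (Fin 2) ℤ)| + 1 = R := by
    rw [hR]
    push_cast
    rfl
  have hlt : 2 * |(M : Matrix (Fin 2) (Fin 2) ℤ) 0 1| * n *
      (|Matrix.trace (M : Matrix (Fin 2) (Fin 2) ℤ)| + 1) ^ T < N := by
    rw [hRe]
    refine lt_of_pow_lt_pow_left₀ 4 (by positivity) ?_
    have hn2 : (n : ℤ) ^ 4 ≤ (N : ℤ) ^ 2 := by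
      have : ((n : ℤ) ^ 2) ^ 2 ≤ (N : ℤ) ^ 2 := by
        gcongr
        exact_mod_cast hnN
      linarith
    have hNpos : (0 : ℤ) < N := by exact_mod_cast hN1
    calc (2 * |(M : Matrix (Fin 2) (Fin 2) ℤ) 0 1| * n * (R : ℤ) ^ T) ^ 4
        = (2 * |(M : Matrix (Fin 2) (Fin 2) ℤ) 0 1|) ^ 4 * (n ^ 4 * ((R : ℤ) ^ T) ^ 4) := by ring
      _ ≤ (2 * |(M : Matrix (Fin 2) (Fin 2) ℤ) 0 1|) ^ 4 * ((N : ℤ) ^ 2 * N) := by gcongr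
      _ < N * ((N : ℤ) ^ 2 * N) := by gcongr
      _ = (N : ℤ) ^ 4 := by ring
  have hinv : ∀ i, ∀ t : ℕ, stateInner N (shiftOp N κ
      (((M : Matrix (Fin 2) (Fin 2) ℤ) ^ t).mulVec ![0, (n : ℤ)]) (φ i)) (φ i) =
      densityCoeff N κ n (φ i) := by
    intro i t
    induction t with
    | zero => simp [densityCoeff]
    | succ t ih =>
      rw [pow_succ', ← Matrix.mulVec_mulVec, stateInner_shiftOp_mulVec hN1 hgen hφ, ih]
  have := sum_norm_sq_stateInner_le hN1 hφ.mem hφ.orthonormal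
    (s := Finset.range (T + 1)) (by simp)
    (fun t => ((M : Matrix (Fin 2) (Fin 2) ℤ) ^ t).mulVec ![0, (n : ℤ)])
    (fun t ht u hu htu => orbitCoord_not_dvd hM hn hlt
      (by simpa [Nat.lt_succ_iff] using ht) (by simpa [Nat.lt_succ_iff] using hu) htu)
    (fun i => densityCoeff N κ n (φ i)) (fun i t _ => hinv i t)
  simpa using this

/-! ### Trapezoidal cutoffs on the circle and their Fourier series -/

/-- The Fourier series of the second Bernoulli polynomial. The term `n = 0` vanishes because `1 / 0
= 0`. -/
theorem hasSum_cos_div_sq {x : ℝ} (h0 : 0 ≤ x) (h1 : x ≤ 1) :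
    HasSum (fun n : ℕ => 1 / (n : ℝ) ^ 2 * Real.cos (2 * Real.pi * n * x))
      (Real.pi ^ 2 * (x ^ 2 - x + 6⁻¹)) := by
  have h := hasSum_one_div_nat_pow_mul_cos (k := 1) one_ne_zero (x := x) ⟨h0, h1⟩
  have hb := bernoulliFun_two x
  rw [bernoulliFun] at hb
  simp only [mul_one] at h
  rw [hb] at h
  convert h using 1
  simp only [Nat.factorial]
  push_cast
  ring

/-- The function equal to `1` on `[0, r]`, to `0` on `[s, ∞)` and affine on `[r, s]`. -/
def trapezoid (r s y : ℝ) : ℝ := (max y s - max y r) / (s - r)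

def trapezoidCoeff (r s : ℝ) (n : ℕ) : ℝ :=
  (Real.cos (2 * Real.pi * n * r) - Real.cos (2 * Real.pi * n * s)) /
    (Real.pi ^ 2 * (s - r) * n ^ 2)

section Trapezoid

variable {r s : ℝ}

theorem trapezoid_nonneg (hrs : r < s) (y : ℝ) : 0 ≤ trapezoid r s y :=
  div_nonneg (sub_nonneg.2 (max_le_max_left y hrs.le)) (by linarith)

theorem trapezoid_le_one (hrs : r < s) (y : ℝ) : trapezoid r s y ≤ 1 := by
  rw [trapezoid, div_le_one (by linarith)]
  rcases le_total y s with h | h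
  · rw [max_eq_right h]
    linarith [le_max_right y r]
  · rw [max_eq_left h]
    linarith [le_max_left y r]

theorem trapezoid_eq_one (hrs : r < s) {y : ℝ} (hy : y ≤ r) : trapezoid r s y = 1 := by
  rw [trapezoid, max_eq_right hy, max_eq_right (hy.trans hrs.le), div_self (by linarith)]

theorem trapezoid_eq_zero (hrs : r < s) {y : ℝ} (hy : s ≤ y) : trapezoid r s y = 0 := by
  rw [trapezoid, max_eq_left hy, max_eq_left (hrs.le.trans hy), sub_self, zero_div]

/-- Combining the Bernoulli series at `y ± r` and `y ± s` cancels the quadratic terms in `y` and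
leaves the kinks `|y - r|` and `|y - s|`. The mean `r + s` is split off, as `trapezoidCoeff` is `0`
at `n = 0`. -/
theorem hasSum_trapezoid (hr : 0 ≤ r) (hrs : r < s) (hs : s ≤ 1 / 2) {y : ℝ} (hy0 : 0 ≤ y)
    (hy1 : y ≤ 1 / 2) :
    HasSum (fun n : ℕ => trapezoidCoeff r s n * Real.cos (2 * Real.pi * n * y))
      (trapezoid r s y - (r + s)) := by
  have hsr : s - r ≠ 0 := by linarith
  have hd : ∀ t, 0 ≤ t → t ≤ 1 / 2 → |y - t| ≤ 1 := fun t h0 h1 =>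
    abs_le.2 ⟨by linarith, by linarith⟩
  have h1 := hasSum_cos_div_sq (x := y + r) (by linarith) (by linarith)
  have h2 := hasSum_cos_div_sq (x := |y - r|) (abs_nonneg _) (hd r hr (by linarith))
  have h3 := hasSum_cos_div_sq (x := y + s) (by linarith) (by linarith)
  have h4 := hasSum_cos_div_sq (x := |y - s|) (abs_nonneg _) (hd s (by linarith) hs)
  have h := (((h1.add h2).sub h3).sub h4).mul_left (1 / (2 * Real.pi ^ 2 * (s - r)))
  have habs : ∀ t, |y - t| = 2 * max y t - y - t := by
    intro t
    rcases le_total y t with h | h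
    · rw [max_eq_right h, abs_of_nonpos (by linarith)]
      ring
    · rw [max_eq_left h, abs_of_nonneg (by linarith)]
      ring
  have hcos : ∀ (n : ℕ) (t : ℝ), Real.cos (2 * Real.pi * n * |y - t|) =
      Real.cos (2 * Real.pi * n * (y - t)) := by
    intro n t
    rcases abs_choice (y - t) with h | h <;> rw [h]
    rw [mul_neg, Real.cos_neg]
  have hv : trapezoid r s y - (r + s) = 1 / (2 * Real.pi ^ 2 * (s - r)) *
      (Real.pi ^ 2 * ((y + r) ^ 2 - (y + r) + 6⁻¹) + Real.pi ^ 2 * (|y - r| ^ 2 - |y - r| + 6⁻¹) -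
        Real.pi ^ 2 * ((y + s) ^ 2 - (y + s) + 6⁻¹) -
        Real.pi ^ 2 * (|y - s| ^ 2 - |y - s| + 6⁻¹)) := by
    rw [sq_abs, sq_abs, habs, habs]
    unfold trapezoid
    field_simp
    ring
  rw [hv]
  refine h.congr_fun fun n => ?_
  rw [hcos, hcos]
  unfold trapezoidCoeff
  simp only [mul_add, mul_sub (2 * Real.pi * (n : ℝ)), Real.cos_add, Real.cos_sub]
  rcases eq_or_ne (n : ℝ) 0 with hn | hn
  · simp [hn]
  · field_simp
    ring

theorem abs_trapezoidCoeff_le_inv (hrs : r < s) (n : ℕ) :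
    |trapezoidCoeff r s n| ≤ 1 / ((s - r) * n ^ 2) := by
  rcases Nat.eq_zero_or_pos n with rfl | hn
  · simp [trapezoidCoeff]
  have hn' : (0 : ℝ) < n := by exact_mod_cast hn
  have hsr : 0 < s - r := by linarith
  rw [trapezoidCoeff, abs_div, abs_of_pos (a := Real.pi ^ 2 * (s - r) * n ^ 2) (by positivity),
    div_le_div_iff₀ (by positivity) (by positivity)]
  have h1 : |Real.cos (2 * Real.pi * n * r) - Real.cos (2 * Real.pi * n * s)| ≤ 2 := by
    rw [abs_le]
    constructor <;> linarith [Real.neg_one_le_cos (2 * Real.pi * n * r),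
      Real.neg_one_le_cos (2 * Real.pi * n * s), Real.cos_le_one (2 * Real.pi * n * r),
      Real.cos_le_one (2 * Real.pi * n * s)]
  have h2 : 2 ≤ Real.pi ^ 2 := by nlinarith [Real.pi_gt_three]
  calc _ ≤ Real.pi ^ 2 * ((s - r) * n ^ 2) := by
        gcongr
        exact h1.trans h2
    _ = _ := by ring

theorem abs_trapezoidCoeff_le (hr : 0 ≤ r) (hrs : r < s) (n : ℕ) :
    |trapezoidCoeff r s n| ≤ 2 * (r + s) := by
  rcases Nat.eq_zero_or_pos n with rfl | hn
  · simp [trapezoidCoeff]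
    linarith
  have hn' : (0 : ℝ) < n := by exact_mod_cast hn
  have hsr : 0 < s - r := by linarith
  rw [trapezoidCoeff, abs_div, abs_of_pos (a := Real.pi ^ 2 * (s - r) * n ^ 2) (by positivity),
    div_le_iff₀ (by positivity), Real.cos_sub_cos, abs_mul, abs_mul]
  have e1 : |Real.sin ((2 * Real.pi * n * r + 2 * Real.pi * n * s) / 2)| ≤
      Real.pi * n * (r + s) := by
    refine Real.abs_sin_le_abs.trans_eq ?_
    rw [show (2 * Real.pi * n * r + 2 * Real.pi * n * s) / 2 = Real.pi * n * (r + s) by ring]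
    exact abs_of_nonneg (mul_nonneg (by positivity) (by linarith))
  have e2 : |Real.sin ((2 * Real.pi * n * r - 2 * Real.pi * n * s) / 2)| ≤
      Real.pi * n * (s - r) := by
    refine Real.abs_sin_le_abs.trans_eq ?_
    rw [show (2 * Real.pi * n * r - 2 * Real.pi * n * s) / 2 = -(Real.pi * n * (s - r)) by ring,
      abs_neg]
    exact abs_of_nonneg (mul_nonneg (by positivity) hsr.le)
  calc _ ≤ |(-2 : ℝ)| * (Real.pi * n * (r + s)) * (Real.pi * n * (s - r)) :=
      mul_le_mul (mul_le_mul_of_nonneg_left e1 (abs_nonneg _)) e2 (abs_nonneg _)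
        (mul_nonneg (abs_nonneg _) (mul_nonneg (by positivity) (by linarith)))
    _ = _ := by
      rw [abs_neg, abs_two]
      ring

end Trapezoid

theorem cos_two_pi_mul_norm (n : ℕ) (u : ℝ) :
    Real.cos (2 * Real.pi * n * ‖(u : UnitAddCircle)‖) = Real.cos (2 * Real.pi * n * u) := by
  rw [UnitAddCircle.norm_eq, ← abs_of_nonneg (by positivity : 0 ≤ 2 * Real.pi * (n : ℝ)),
    ← abs_mul, Real.cos_abs, abs_of_nonneg (by positivity : 0 ≤ 2 * Real.pi * (n : ℝ)), mul_sub,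
    show 2 * Real.pi * (n : ℝ) * (round u : ℝ) = ((n * round u : ℤ) : ℝ) * (2 * Real.pi) by
      push_cast; ring]
  exact Real.cos_sub_int_mul_two_pi _ _

/-! ### From Fourier coefficients to masses of balls -/

section PointMasses

variable {ι : Type*} {S : Finset ι} {p x : ι → ℝ}

/-- The modulus of the `n`-th Fourier coefficient of `∑ₖ pₖ δ(xₖ)`. -/
def fourierModulus (S : Finset ι) (p x : ι → ℝ) (n : ℕ) : ℝ :=
  ‖∑ k ∈ S, (p k : ℂ) * Complex.exp (-(2 * Real.pi * Complex.I * n * x k))‖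

theorem abs_sum_mul_cos_le (n : ℕ) (q : ℝ) :
    |∑ k ∈ S, p k * Real.cos (2 * Real.pi * n * (x k - q))| ≤ fourierModulus S p x n := by
  have h : ∑ k ∈ S, p k * Real.cos (2 * Real.pi * n * (x k - q)) =
      (Complex.exp ((2 * Real.pi * n * q : ℝ) * Complex.I) * ∑ k ∈ S, (p k : ℂ) *
        Complex.exp (-(2 * Real.pi * Complex.I * n * x k))).re := by
    rw [Finset.mul_sum, Complex.re_sum]
    refine Finset.sum_congr rfl fun k _ => ?_
    rw [mul_left_comm, ← Complex.exp_add, Complex.re_ofReal_mul,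
      show ((2 * Real.pi * n * q : ℝ) : ℂ) * Complex.I + -(2 * Real.pi * Complex.I * n * x k) =
        ((-(2 * Real.pi * n * (x k - q)) : ℝ) : ℂ) * Complex.I by push_cast; ring,
      Complex.exp_ofReal_mul_I_re, Real.cos_neg]
  rw [h]
  refine (Complex.abs_re_le_norm _).trans_eq ?_
  rw [norm_mul, Complex.norm_exp_ofReal_mul_I, one_mul, fourierModulus]

theorem fourierModulus_le_one (hp : ∀ k ∈ S, 0 ≤ p k) (hp1 : ∑ k ∈ S, p k = 1) (n : ℕ) :
    fourierModulus S p x n ≤ 1 := by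
  rw [fourierModulus, ← hp1]
  refine (norm_sum_le _ _).trans_eq (Finset.sum_congr rfl fun k hk => ?_)
  rw [norm_mul, Complex.norm_real, Real.norm_of_nonneg (hp k hk),
    show -(2 * Real.pi * Complex.I * n * x k) = ((-(2 * Real.pi * n * x k) : ℝ) : ℂ) * Complex.I by
      push_cast; ring, Complex.norm_exp_ofReal_mul_I, mul_one]

/-- Integrate the cosine series against the masses. Beyond `L` the moduli are bounded by `1`, and
the tail of `1 / n²` is at most `1 / L`. No bound depends on `q`, which only rotates phases. -/
theorem abs_sum_trapezoid_sub_le (hp : ∀ k ∈ S, 0 ≤ p k) (hp1 : ∑ k ∈ S, p k = 1) {r s : ℝ}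
    (hr : 0 ≤ r) (hrs : r < s) (hs : s ≤ 1 / 2) {L : ℕ} (hL : 1 ≤ L) (q : UnitAddCircle) :
    |∑ k ∈ S, p k * trapezoid r s ‖(x k : UnitAddCircle) - q‖ - (r + s)| ≤
      ∑ n ∈ Finset.Icc 1 L, |trapezoidCoeff r s n| * fourierModulus S p x n +
        1 / ((s - r) * L) := by
  obtain ⟨q, rfl⟩ := QuotientAddGroup.mk_surjective q
  have hsr : 0 < s - r := by linarith
  have hsum : HasSum (fun n : ℕ => trapezoidCoeff r s n *
      ∑ k ∈ S, p k * Real.cos (2 * Real.pi * n * (x k - q)))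
      (∑ k ∈ S, p k * trapezoid r s ‖(x k : UnitAddCircle) - (q : UnitAddCircle)‖ - (r + s)) := by
    have h : ∀ k ∈ S, HasSum (fun n : ℕ => p k * (trapezoidCoeff r s n *
        Real.cos (2 * Real.pi * n * (x k - q))))
        (p k * (trapezoid r s ‖(x k : UnitAddCircle) - (q : UnitAddCircle)‖ - (r + s))) := by
      intro k _
      rw [← AddCircle.coe_sub]
      have := (hasSum_trapezoid hr hrs hs (norm_nonneg ((x k - q : ℝ) : UnitAddCircle))
        (by simpa using AddCircle.norm_le_half_period (p := 1)
              (x := ((x k - q : ℝ) : UnitAddCircle)) one_ne_zero)).mul_left (p k)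
      simpa only [cos_two_pi_mul_norm] using this
    have h2 := hasSum_sum h
    simp only [mul_sub (p _) (trapezoid _ _ _)] at h2
    rw [Finset.sum_sub_distrib, ← Finset.sum_mul, hp1, one_mul] at h2
    refine h2.congr_fun fun n => ?_
    rw [Finset.mul_sum]
    exact Finset.sum_congr rfl fun k _ => mul_left_comm _ _ _
  refine le_of_tendsto hsum.tendsto_sum_nat.abs (Eventually.of_forall fun m => ?_)
  have hc0 : ∀ n, 0 ≤ fourierModulus S p x n := fun n => norm_nonneg _
  set f : ℕ → ℝ := fun n => |trapezoidCoeff r s n| * fourierModulus S p x n with hf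
  have hf0 : ∀ n, 0 ≤ f n := fun n => mul_nonneg (abs_nonneg _) (hc0 n)
  calc _ ≤ ∑ n ∈ Finset.range m, f n := by
        refine (Finset.abs_sum_le_sum_abs _ _).trans (Finset.sum_le_sum fun n _ => ?_)
        rw [abs_mul]
        exact mul_le_mul_of_nonneg_left (abs_sum_mul_cos_le n q) (abs_nonneg _)
    _ ≤ ∑ n ∈ insert 0 (Finset.Icc 1 L ∪ Finset.Ioc L (max L m)), f n := by
        refine Finset.sum_le_sum_of_subset_of_nonneg (fun n hn => ?_) fun n _ _ => hf0 n
        simp only [Finset.mem_range, Finset.mem_insert, Finset.mem_union, Finset.mem_Icc,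
          Finset.mem_Ioc, le_max_iff] at hn ⊢
        omega
    _ = ∑ n ∈ Finset.Icc 1 L ∪ Finset.Ioc L (max L m), f n :=
        Finset.sum_insert_zero (by simp [hf, trapezoidCoeff])
    _ = ∑ n ∈ Finset.Icc 1 L, f n + ∑ n ∈ Finset.Ioc L (max L m), f n := by
        refine Finset.sum_union (Finset.disjoint_left.2 fun n hn hn' => ?_)
        simp only [Finset.mem_Icc, Finset.mem_Ioc] at hn hn'
        omega
    _ ≤ ∑ n ∈ Finset.Icc 1 L, f n + 1 / ((s - r) * L) := by
        gcongr
        have h1 : ∀ n ∈ Finset.Ioc L (max L m), f n ≤ (1 / (s - r)) * ((n : ℝ) ^ 2)⁻¹ := by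
          intro n _
          refine (mul_le_of_le_one_right (abs_nonneg _) (fourierModulus_le_one hp hp1 n)).trans ?_
          refine (abs_trapezoidCoeff_le_inv hrs n).trans_eq ?_
          rw [one_div_mul_eq_div, inv_eq_one_div, div_div, mul_comm]
        refine (Finset.sum_le_sum h1).trans ?_
        rw [← Finset.mul_sum, ← one_div_mul_one_div]
        gcongr
        refine (sum_Ioc_inv_sq_le_sub (by omega) (le_max_left _ _)).trans ?_
        rw [one_div]
        exact sub_le_self _ (by positivity)

/-- The mass of a ball, in terms of the Fourier coefficients. -/
theorem abs_ball_mass_sub_le (hp : ∀ k ∈ S, 0 ≤ p k) (hp1 : ∑ k ∈ S, p k = 1) {r δ : ℝ}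
    (hr : 0 < r) (hr4 : r ≤ 1 / 4) (hδ0 : 0 < δ) (hδ1 : δ ≤ 1) {L : ℕ} (hL : 1 ≤ L)
    (q : UnitAddCircle) :
    |∑ k ∈ S, p k * (Metric.ball q r).indicator 1 (x k : UnitAddCircle) - 2 * r| ≤
      δ * r + 6 / δ * ∑ n ∈ Finset.Icc 1 L, min r (1 / (r * n ^ 2)) * fourierModulus S p x n +
        1 / (δ * r * L) := by
  have hc0 : ∀ n, 0 ≤ fourierModulus S p x n := fun n => norm_nonneg _
  have hδr : 0 < δ * r := by positivity
  have hδr' : δ * r ≤ r := by nlinarith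
  -- Both trapezoids used below have a ramp of width `δ r` and parameters of sum at most `3 r`. The
  -- factor `6` comes from `2 (a + b) ≤ 6 r`.
  have hcoef : ∀ a b : ℝ, 0 ≤ a → b - a = δ * r → a + b ≤ 3 * r →
      ∑ n ∈ Finset.Icc 1 L, |trapezoidCoeff a b n| * fourierModulus S p x n ≤
        6 / δ * ∑ n ∈ Finset.Icc 1 L, min r (1 / (r * n ^ 2)) * fourierModulus S p x n := by
    intro a b ha hab hab3
    rw [Finset.mul_sum]
    refine Finset.sum_le_sum fun n hn => ?_
    have hn' : (0 : ℝ) < n := by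
      have := (Finset.mem_Icc.1 hn).1
      exact_mod_cast this
    rw [← mul_assoc]
    refine mul_le_mul_of_nonneg_right ?_ (hc0 n)
    rw [mul_min_of_nonneg _ _ (by positivity)]
    refine le_min ?_ ?_
    · refine (abs_trapezoidCoeff_le ha (by linarith) n).trans ?_
      rw [div_mul_eq_mul_div, le_div_iff₀ hδ0]
      nlinarith
    · refine (abs_trapezoidCoeff_le_inv (by linarith) n).trans ?_
      rw [hab, div_mul_div_comm, ← mul_assoc, mul_one]
      gcongr
      norm_num
  -- The outer and inner trapezoids have means `2 r + δ r` and `2 r - δ r`, hence the error `δ r`.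
  -- The outer one fits in the circle because `r ≤ 1 / 4` and `δ ≤ 1`.
  have hup := abs_sum_trapezoid_sub_le (x := x) hp hp1 hr.le (by linarith : r < r + δ * r)
    (by linarith) hL q
  have hlo := abs_sum_trapezoid_sub_le (x := x) hp hp1 (by linarith : 0 ≤ r - δ * r)
    (by linarith : r - δ * r < r) (by linarith) hL q
  have hup' := hcoef r (r + δ * r) hr.le (by ring) (by linarith)
  have hlo' := hcoef (r - δ * r) r (by linarith) (by ring) (by linarith)
  have h1 : ∑ k ∈ S, p k * (Metric.ball q r).indicator 1 (x k : UnitAddCircle) ≤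
      ∑ k ∈ S, p k * trapezoid r (r + δ * r) ‖(x k : UnitAddCircle) - q‖ := by
    refine Finset.sum_le_sum fun k hk => mul_le_mul_of_nonneg_left ?_ (hp k hk)
    by_cases h : (x k : UnitAddCircle) ∈ Metric.ball q r
    · rw [Set.indicator_of_mem h, trapezoid_eq_one (by linarith) (mem_ball_iff_norm.1 h).le]
      rfl
    · rw [Set.indicator_of_notMem h]
      exact trapezoid_nonneg (by linarith) _
  have h2 : ∑ k ∈ S, p k * trapezoid (r - δ * r) r ‖(x k : UnitAddCircle) - q‖ ≤
      ∑ k ∈ S, p k * (Metric.ball q r).indicator 1 (x k : UnitAddCircle) := by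
    refine Finset.sum_le_sum fun k hk => mul_le_mul_of_nonneg_left ?_ (hp k hk)
    by_cases h : (x k : UnitAddCircle) ∈ Metric.ball q r
    · rw [Set.indicator_of_mem h]
      exact trapezoid_le_one (by linarith) _
    · rw [Set.indicator_of_notMem h, trapezoid_eq_zero (by linarith)
        (not_lt.1 fun h' => h (mem_ball_iff_norm.2 h'))]
  rw [add_sub_cancel_left] at hup
  rw [sub_sub_cancel] at hlo
  rw [abs_le] at hup hlo ⊢
  constructor <;> linarith [hup.1, hup.2, hlo.1, hlo.2]

end PointMasses

/-- Split at `n ≈ 1 / r`: about `1 / r` terms of size `r`, then a tail of order `(1 / r) · r`.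
Uniformity in `r` and `L` means that small balls cost nothing in the mean. -/
theorem sum_min_le {r : ℝ} (hr : 0 < r) (hr1 : r ≤ 1) (L : ℕ) :
    ∑ n ∈ Finset.Icc 1 L, min r (1 / (r * n ^ 2)) ≤ 3 := by
  set P := ⌈1 / r⌉₊ with hP
  have hP1 : 1 / r ≤ P := Nat.le_ceil _
  have hP2 : (P : ℝ) < 1 / r + 1 := Nat.ceil_lt_add_one (by positivity)
  have hP0 : P ≠ 0 := (Nat.ceil_pos.2 (by positivity)).ne'
  have hf0 : ∀ n : ℕ, 0 ≤ min r (1 / (r * n ^ 2)) := fun n => le_min hr.le (by positivity)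
  calc ∑ n ∈ Finset.Icc 1 L, min r (1 / (r * n ^ 2))
      ≤ ∑ n ∈ Finset.Icc 1 P ∪ Finset.Ioc P (max P L), min r (1 / (r * (n : ℝ) ^ 2)) := by
        refine Finset.sum_le_sum_of_subset_of_nonneg (fun n hn => ?_) fun n _ _ => hf0 n
        simp only [Finset.mem_union, Finset.mem_Icc, Finset.mem_Ioc, le_max_iff] at hn ⊢
        omega
    _ = ∑ n ∈ Finset.Icc 1 P, min r (1 / (r * (n : ℝ) ^ 2)) +
        ∑ n ∈ Finset.Ioc P (max P L), min r (1 / (r * (n : ℝ) ^ 2)) := by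
        refine Finset.sum_union (Finset.disjoint_left.2 fun n hn hn' => ?_)
        simp only [Finset.mem_Icc, Finset.mem_Ioc] at hn hn'
        omega
    _ ≤ ∑ n ∈ Finset.Icc 1 P, r + ∑ n ∈ Finset.Ioc P (max P L), 1 / r * ((n : ℝ) ^ 2)⁻¹ := by
        gcongr with n _ n _
        · exact min_le_left _ _
        · refine (min_le_right _ _).trans_eq ?_
          rw [← one_div_mul_one_div, one_div ((n : ℝ) ^ 2)]
    _ ≤ 2 + 1 := by
        gcongr
        · simp only [Finset.sum_const, Nat.card_Icc, add_tsub_cancel_right, nsmul_eq_mul]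
          calc (P : ℝ) * r ≤ (1 / r + 1) * r := by gcongr
            _ = 1 + r := by field_simp
            _ ≤ 2 := by linarith
        · rw [← Finset.mul_sum]
          have h := sum_Ioc_inv_sq_le_sub (α := ℝ) hP0 (le_max_left P L)
          have h2 : (P : ℝ)⁻¹ ≤ r := by
            rw [inv_le_comm₀ (by positivity) hr, ← one_div]
            exact hP1
          calc _ ≤ 1 / r * r := by
                gcongr
                refine h.trans ((sub_le_self _ (by positivity)).trans h2)
            _ = 1 := by field_simp
    _ = 3 := by norm_num

/-! ### Position densities of states -/

theorem positionMeasure_real {N : ℕ} (κ : ℝ × ℝ) (Ψ : ℤ → ℂ) {B : Set UnitAddCircle}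
    (hB : MeasurableSet B) :
    (positionMeasure N κ Ψ).real B = ∑ k ∈ Finset.Icc 1 N, ‖Ψ (k : ℤ)‖ ^ 2 / N *
      B.indicator 1 ((((k : ℝ) + κ.1) / N : ℝ) : UnitAddCircle) := by
  rw [Measure.real, positionMeasure, Measure.finsetSum_apply, ENNReal.toReal_sum]
  · refine Finset.sum_congr rfl fun k _ => ?_
    rw [Measure.smul_apply, Measure.dirac_apply' _ hB, smul_eq_mul, ENNReal.toReal_mul,
      ENNReal.toReal_ofReal (by positivity)]
    congr 1
    by_cases h : ((((k : ℝ) + κ.1) / N : ℝ) : UnitAddCircle) ∈ B <;> simp [h]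
  · intro k _
    rw [Measure.smul_apply, Measure.dirac_apply' _ hB, smul_eq_mul]
    by_cases h : ((((k : ℝ) + κ.1) / N : ℝ) : UnitAddCircle) ∈ B <;> simp [h]

theorem sum_norm_sq_div_eq_one {N : ℕ} {Ψ : ℤ → ℂ} (hΨ : stateInner N Ψ Ψ = 1) :
    ∑ k ∈ Finset.Icc 1 N, ‖Ψ (k : ℤ)‖ ^ 2 / N = 1 := by
  rw [← Finset.sum_div]
  simp only [stateInner, Complex.mul_conj'] at hΨ
  rw [one_div_mul_eq_div] at hΨ
  exact_mod_cast hΨ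

theorem fourierModulus_eq_norm_densityCoeff (N : ℕ) (κ : ℝ × ℝ) (Ψ : ℤ → ℂ) (n : ℕ) :
    fourierModulus (Finset.Icc 1 N) (fun k : ℕ => ‖Ψ (k : ℤ)‖ ^ 2 / N)
      (fun k : ℕ => ((k : ℝ) + κ.1) / N) n = ‖densityCoeff N κ n Ψ‖ := by
  rw [fourierModulus, densityCoeff, stateInner, Finset.mul_sum]
  congr 1
  refine Finset.sum_congr rfl fun k _ => ?_
  simp only [shiftOp, Matrix.cons_val_zero, Matrix.cons_val_one, Matrix.cons_val_fin_one, add_zero]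
  rw [mul_assoc (Complex.exp _), Complex.mul_conj']
  push_cast
  ring_nf

theorem volume_real_ball (q : UnitAddCircle) {r : ℝ} (hr : 0 ≤ r) (hr2 : r ≤ 1 / 2) :
    volume.real (Metric.ball q r) = 2 * r := by
  rw [Measure.real, ← measure_congr AddCircle.closedBall_ae_eq_ball, AddCircle.volume_closedBall,
    min_eq_right (by linarith), ENNReal.toReal_ofReal (by linarith)]

theorem ball_one_eq_univ (q : UnitAddCircle) : Metric.ball q 1 = Set.univ := by
  refine Set.eq_univ_of_forall fun x => mem_ball_iff_norm.2 ?_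
  have := AddCircle.norm_le_half_period (p := (1 : ℝ)) (x := x - q) one_ne_zero
  rw [abs_one] at this
  exact this.trans_lt (by norm_num)

/-- A weighted sum of the Fourier coefficients of the position density, which controls its
discrepancy on balls of radius `r`. -/
def discrepancyBound (N : ℕ) (κ : ℝ × ℝ) (r : ℝ) (Ψ : ℤ → ℂ) : ℝ :=
  ∑ n ∈ Finset.Icc 1 N.sqrt, min r (1 / (r * n ^ 2)) * ‖densityCoeff N κ n Ψ‖

theorem abs_positionMeasure_ball_sub_le {N : ℕ} (hN : 1 ≤ N) (κ : ℝ × ℝ) {Ψ : ℤ → ℂ}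
    (hΨ : stateInner N Ψ Ψ = 1) {r δ : ℝ} (hr : 0 < r) (hr4 : r ≤ 1 / 4) (hδ0 : 0 < δ)
    (hδ1 : δ ≤ 1) (q : UnitAddCircle) :
    |(positionMeasure N κ Ψ).real (Metric.ball q r) - volume.real (Metric.ball q r)| ≤
      δ * r + 6 / δ * discrepancyBound N κ r Ψ + 1 / (δ * r * N.sqrt) := by
  rw [positionMeasure_real κ Ψ measurableSet_ball, volume_real_ball q hr.le (by linarith)]
  have := abs_ball_mass_sub_le (S := Finset.Icc 1 N) (p := fun k : ℕ => ‖Ψ (k : ℤ)‖ ^ 2 / N)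
    (x := fun k : ℕ => ((k : ℝ) + κ.1) / N) (fun k _ => by positivity)
    (sum_norm_sq_div_eq_one hΨ) hr hr4 hδ0 hδ1 (Nat.sqrt_pos.2 hN) q
  simpa only [fourierModulus_eq_norm_densityCoeff, discrepancyBound] using this

theorem exists_sum_discrepancyBound_le {M : Matrix.SpecialLinearGroup (Fin 2) ℤ}
    (hM : 2 < |Matrix.trace (M : Matrix (Fin 2) (Fin 2) ℤ)|) {ε : ℤˣ} {a b c : ℝ}
    (hgen : IsGenerator M ε a b c) :
    ∃ C : ℝ, ∃ N₀ : ℕ, ∀ N ≥ N₀, ∀ (κ : ℝ × ℝ) (φ : Fin N → ℤ → ℂ), IsEigenbasis N ε a b c κ φ →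
      ∀ r : ℝ, 0 < r → r ≤ 1 →
        ∑ j, discrepancyBound N κ r (φ j) ≤ C * N * Real.log N ^ (-(1 / 2) : ℝ) := by
  set R := (Matrix.trace (M : Matrix (Fin 2) (Fin 2) ℤ)).natAbs + 1 with hR
  have hR1 : 1 < R ^ 4 := by
    refine Nat.one_lt_pow (by norm_num) ?_
    rw [Int.abs_eq_natAbs] at hM
    omega
  set D := Real.log ((R ^ 4 : ℕ) : ℝ) with hD
  have hD0 : 0 < D := Real.log_pos (by exact_mod_cast hR1)
  -- The factor `3` is the bound of `sum_min_le`, and `√D` converts the time `T + 1 ≥ log N / D`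
  -- into `log N`. The threshold ensures `log N > 0` and the size condition of the variance bound.
  refine ⟨3 * √D, max 2 (((2 * |(M : Matrix (Fin 2) (Fin 2) ℤ) 0 1|) ^ 4).toNat + 1),
    fun N hN κ φ hφ r hr hr1 => ?_⟩
  have hN2 : 2 ≤ N := (le_max_left _ _).trans hN
  have hNM : (2 * |(M : Matrix (Fin 2) (Fin 2) ℤ) 0 1|) ^ 4 < N := by
    have := (le_max_right _ _).trans hN
    omega
  have hN0 : (0 : ℝ) < N := by exact_mod_cast (by omega : 0 < N)
  have hl : 0 < Real.log N := Real.log_pos (by exact_mod_cast (by omega : 1 < N))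
  set T := Nat.log (R ^ 4) N with hT
  have hTl : Real.log N ≤ (T + 1) * D := by
    have h := Nat.lt_pow_succ_log_self hR1 N
    have h2 : (N : ℝ) ≤ ((R ^ 4 : ℕ) : ℝ) ^ (T + 1) := by exact_mod_cast h.le
    have h3 := Real.log_le_log hN0 h2
    rw [Real.log_pow] at h3
    exact_mod_cast h3
  have hcoef : ∀ n ∈ Finset.Icc 1 N.sqrt, ∑ j, ‖densityCoeff N κ n (φ j)‖ ≤
      N * (√D * Real.log N ^ (-(1 / 2) : ℝ)) := by
    intro n hn
    rw [Finset.mem_Icc] at hn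
    have hv := sum_norm_sq_densityCoeff_le hM hgen hNM hφ hn.1
      (by rw [pow_two]; exact Nat.le_sqrt.1 hn.2)
    -- Cauchy–Schwarz over the `N` states passes from the variance to the mean of the moduli, which
    -- is why the exponent is `1/2`.
    have hcs := sq_sum_le_card_mul_sum_sq (s := Finset.univ)
      (f := fun j => ‖densityCoeff N κ n (φ j)‖)
    rw [Finset.card_univ, Fintype.card_fin] at hcs
    refine le_of_sq_le_sq ?_ (by positivity)
    calc (∑ j, ‖densityCoeff N κ n (φ j)‖) ^ 2
        ≤ N * (N / ((T : ℝ) + 1)) := hcs.trans (by gcongr)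
      _ ≤ N * (N * (D / Real.log N)) := by
          rw [div_eq_mul_one_div]
          gcongr N * (N * ?_)
          rw [div_le_div_iff₀ (by positivity) hl]
          linarith
      _ = (N * (√D * Real.log N ^ (-(1 / 2) : ℝ))) ^ 2 := by
          rw [mul_pow, mul_pow, Real.sq_sqrt hD0.le, ← Real.rpow_natCast (Real.log N ^ _),
            ← Real.rpow_mul hl.le]
          norm_num
          rw [Real.rpow_neg_one]
          ring
  simp only [discrepancyBound]
  rw [Finset.sum_comm]
  calc ∑ n ∈ Finset.Icc 1 N.sqrt, ∑ j, min r (1 / (r * n ^ 2)) * ‖densityCoeff N κ n (φ j)‖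
      ≤ ∑ n ∈ Finset.Icc 1 N.sqrt, min r (1 / (r * n ^ 2)) *
        (N * (√D * Real.log N ^ (-(1 / 2) : ℝ))) := by
        refine Finset.sum_le_sum fun n hn => ?_
        rw [← Finset.mul_sum]
        exact mul_le_mul_of_nonneg_left (hcoef n hn) (le_min hr.le (by positivity))
    _ ≤ 3 * (N * (√D * Real.log N ^ (-(1 / 2) : ℝ))) := by
        rw [← Finset.sum_mul]
        exact mul_le_mul_of_nonneg_right (sum_min_le hr hr1 _) (by positivity)
    _ = _ := by ring

/-! ### Markov's inequality and the growth of `log N` -/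

theorem card_filter_lt_mul_le {ι : Type*} [Fintype ι] (X : ι → ℝ) (hX : ∀ j, 0 ≤ X j) {A B : ℝ}
    (hB : ∑ j, X j ≤ B) :
    ((Fintype.card ι : ℝ) - (Finset.univ.filter fun j => X j ≤ A).card) * A ≤ B := by
  have hc := Finset.card_filter_add_card_filter_not (s := Finset.univ) fun j => X j ≤ A
  have hc' : ((Fintype.card ι : ℝ) - (Finset.univ.filter fun j => X j ≤ A).card) =
      ((Finset.univ.filter fun j => ¬ X j ≤ A).card : ℝ) := by
    rw [Finset.card_univ] at hc
    rw [← hc]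
    push_cast
    ring
  rw [hc', ← nsmul_eq_mul]
  refine (Finset.card_nsmul_le_sum _ X A fun j hj => ?_).trans
    ((Finset.sum_le_sum_of_subset_of_nonneg (Finset.subset_univ _) fun j _ _ => hX j).trans hB)
  exact (not_le.1 (Finset.mem_filter.1 hj).2).le

theorem tendsto_log_natCast : Tendsto (fun N : ℕ => Real.log N) atTop atTop :=
  Real.tendsto_log_atTop.comp tendsto_natCast_atTop_atTop

theorem eventually_log_le_mul_sqrt {η : ℝ} (hη : 0 < η) :
    ∀ᶠ N : ℕ in atTop, Real.log N ≤ η * (N.sqrt : ℝ) := by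
  have h := (isLittleO_log_rpow_atTop (r := 1 / 2) (by norm_num)).bound
    (by positivity : 0 < η / 2)
  filter_upwards [tendsto_natCast_atTop_atTop.eventually h, eventually_ge_atTop 4] with N hN hN4
  rw [Real.norm_of_nonneg (by positivity : (0 : ℝ) ≤ (N : ℝ) ^ (1 / 2 : ℝ)),
    ← Real.sqrt_eq_rpow] at hN
  have h1 := (le_abs_self _).trans hN
  have h2 : √(N : ℝ) ≤ N.sqrt + 1 := by
    rw [Real.sqrt_le_left (by positivity)]
    exact_mod_cast (Nat.lt_succ_sqrt' N).le
  have h3 : (1 : ℝ) ≤ N.sqrt := by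
    exact_mod_cast Nat.sqrt_pos.2 (by omega : 0 < N)
  nlinarith

end QuantumCat

end

/-! ### Equidistribution at logarithmical scales -/

theorem theorem1p1
    (M : Matrix.SpecialLinearGroup (Fin 2) ℤ)
    (hM : 2 < |Matrix.trace (M : Matrix (Fin 2) (Fin 2) ℤ)|)
    (ε : ℤˣ) (a b c : ℝ) (hgen : QuantumCat.IsGenerator M ε a b c)
    (α : ℝ) (hα₀ : 0 ≤ α) (hα : α < 1 / 2)
    (κ : ℕ → ℝ × ℝ) (hκ : ∀ N, 1 ≤ N → QuantumCat.PreservesStates N ε a b c (κ N))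
    (φ : (N : ℕ) → Fin N → ℤ → ℂ)
    (hφ : ∀ N, 1 ≤ N → QuantumCat.IsEigenbasis N ε a b c (κ N) (φ N)) :
    ∃ S : (N : ℕ) → Finset (Fin N),
      Filter.Tendsto (fun N : ℕ => ((S N).card : ℝ) / N) Filter.atTop (nhds 1) ∧
      ∀ δ : ℝ, 0 < δ → ∀ᶠ N : ℕ in Filter.atTop, ∀ j ∈ S N, ∀ q : UnitAddCircle,
        |(QuantumCat.positionMeasure N (κ N) (φ N j)).real
            (Metric.ball q (Real.log N ^ (-α))) -
          MeasureTheory.volume.real (Metric.ball q (Real.log N ^ (-α)))| ≤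
        δ * Real.log N ^ (-α) := by
  -- For `α = 0` the radius is `1`, so the ball is the whole circle and both masses equal `1`. This
  -- case is separate because the Fourier estimate needs `r ≤ 1 / 4`.
  rcases hα₀.eq_or_lt with rfl | hα₀
  · refine ⟨fun N => Finset.univ, ?_, fun δ hδ => ?_⟩
    · refine tendsto_const_nhds.congr' ?_
      filter_upwards [eventually_ge_atTop 1] with N hN
      have : (N : ℝ) ≠ 0 := by exact_mod_cast (by omega : N ≠ 0)
      rw [Finset.card_univ, Fintype.card_fin, div_self this]
    · filter_upwards [eventually_ge_atTop 1] with N hN j _ q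
      have h1 : QuantumCat.stateInner N (φ N j) (φ N j) = 1 := by
        simp [(hφ N hN).orthonormal]
      rw [neg_zero, Real.rpow_zero, QuantumCat.ball_one_eq_univ,
        QuantumCat.positionMeasure_real _ _ MeasurableSet.univ]
      simp only [Set.indicator_univ, Pi.one_apply, mul_one]
      rw [QuantumCat.sum_norm_sq_div_eq_one h1]
      simp [MeasureTheory.Measure.real, hδ.le]
  obtain ⟨C, N₀, hC⟩ := QuantumCat.exists_sum_discrepancyBound_le hM hgen
  -- Chosen so that `1/2 = α + 2 γ`: one factor `(log N)^(-γ)` makes the discrepancy `o(r)`, the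
  -- other bounds the exceptional proportion.
  set γ := (1 / 2 - α) / 2 with hγ
  have hγ0 : 0 < γ := by rw [hγ]; linarith
  have hlog := QuantumCat.tendsto_log_natCast
  have hrlim := (tendsto_rpow_neg_atTop hα₀).comp hlog
  have hγlim := (tendsto_rpow_neg_atTop hγ0).comp hlog
  -- The selection involves neither the centre `q` nor the tolerance `δ`, so the estimate is uniform
  -- on a single set.
  refine ⟨fun N => Finset.univ.filter fun j => QuantumCat.discrepancyBound N (κ N)
    (Real.log N ^ (-α)) (φ N j) ≤ Real.log N ^ (-α) * Real.log N ^ (-γ), ?_, fun δ hδ => ?_⟩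
  · have hlow : Tendsto (fun N : ℕ => 1 - C * Real.log N ^ (-γ)) atTop (𝓝 1) := by
      simpa using (hγlim.const_mul C).const_sub 1
    refine tendsto_of_tendsto_of_tendsto_of_le_of_le' hlow tendsto_const_nhds ?_ ?_
    · filter_upwards [eventually_ge_atTop N₀, eventually_ge_atTop 1,
        hlog.eventually_ge_atTop 1] with N hN hN1 hl
      have hl0 : 0 < Real.log N := by linarith
      have hN0 : (0 : ℝ) < N := by exact_mod_cast hN1
      have hr0 : 0 < Real.log N ^ (-α) := Real.rpow_pos_of_pos hl0 _
      have hr1 : Real.log N ^ (-α) ≤ 1 := Real.rpow_le_one_of_one_le_of_nonpos hl (by linarith)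
      have h := QuantumCat.card_filter_lt_mul_le
        (fun j => QuantumCat.discrepancyBound N (κ N) (Real.log N ^ (-α)) (φ N j))
        (fun j => Finset.sum_nonneg fun n _ =>
          mul_nonneg (le_min hr0.le (by positivity)) (norm_nonneg _))
        (A := Real.log N ^ (-α) * Real.log N ^ (-γ))
        (hC N hN (κ N) (φ N) (hφ N hN1) _ hr0 hr1)
      rw [Fintype.card_fin] at h
      have hexp : Real.log N ^ (-(1 / 2) : ℝ) =
          Real.log N ^ (-α) * Real.log N ^ (-γ) * Real.log N ^ (-γ) := by
        rw [← Real.rpow_add hl0, ← Real.rpow_add hl0]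
        congr 1
        rw [hγ]
        ring
      have hA : 0 < Real.log N ^ (-α) * Real.log N ^ (-γ) :=
        mul_pos hr0 (Real.rpow_pos_of_pos hl0 _)
      have h' : (N : ℝ) - _ ≤ C * N * Real.log N ^ (-γ) :=
        le_of_mul_le_mul_right (h.trans_eq (by rw [hexp]; ring)) hA
      rw [le_div_iff₀ hN0]
      linarith
    · filter_upwards [eventually_ge_atTop 1] with N hN
      have hN0 : (0 : ℝ) < N := by exact_mod_cast hN
      rw [div_le_one hN0]
      exact_mod_cast (Finset.card_le_univ _).trans_eq (Fintype.card_fin N)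
  -- Each of the three error terms will be at most `η r`. The minimum with `1` makes `η` admissible
  -- as the relative ramp width.
  · set η := min δ 1 / 3 with hη
    have hη0 : 0 < η := by positivity
    have hη1 : η ≤ 1 := by
      have := min_le_right δ 1
      rw [hη]; linarith
    have hη3 : 3 * η ≤ δ := by
      have := min_le_left δ 1
      rw [hη]; linarith
    filter_upwards [eventually_ge_atTop 1, hlog.eventually_ge_atTop 1,
      hrlim.eventually_le_const (by norm_num : (0 : ℝ) < 1 / 4),
      hγlim.eventually_le_const (by positivity : 0 < η ^ 2 / 6),
      QuantumCat.eventually_log_le_mul_sqrt (by positivity : 0 < η ^ 2)]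
      with N hN1 hl hr4 hg hL j hj q
    simp only [Function.comp_apply] at hr4 hg
    have hl0 : 0 < Real.log N := by linarith
    have hL0 : (0 : ℝ) < N.sqrt := by exact_mod_cast Nat.sqrt_pos.2 hN1
    have hj' := (Finset.mem_filter.1 hj).2
    -- Here `2 α < 1` gives `r² log N ≥ 1`. With `log N ≤ η² √N` this absorbs the truncation error
    -- `1 / (η r √N)`, where `√N` is the integer square root.
    have hr2 : 1 / Real.log N ≤ Real.log N ^ (-α) * Real.log N ^ (-α) := by
      rw [← Real.rpow_add hl0, one_div, ← Real.rpow_neg_one]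
      exact Real.rpow_le_rpow_of_exponent_le hl (by linarith)
    have hr0 : 0 < Real.log N ^ (-α) := Real.rpow_pos_of_pos hl0 _
    set r := Real.log N ^ (-α)
    refine (QuantumCat.abs_positionMeasure_ball_sub_le hN1 (κ N)
      (by simp [(hφ N hN1).orthonormal]) hr0 hr4 hη0 hη1 q).trans ?_
    have h2 : 6 / η * QuantumCat.discrepancyBound N (κ N) r (φ N j) ≤ η * r := by
      calc _ ≤ 6 / η * (r * (η ^ 2 / 6)) := by
            gcongr
            exact hj'.trans (by gcongr)
        _ = η * r := by field_simp
    have h3 : 1 / (η * r * N.sqrt) ≤ η * r := by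
      rw [div_le_iff₀ (by positivity)]
      rw [div_le_iff₀ hl0] at hr2
      nlinarith [mul_pos hr0 hr0]
    nlinarith
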